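/- Let $d\ge 1$, let $\mathcal{E}$ be a Polish space with its Borel $\sigma$-algebra and a probability measure $\mathcal{P}$, and let $\nu=\mathrm{Leb}\otimes\mathcal{P}$ on $\mathbb{X}=\mathbb{R}^d\times\mathcal{E}$. Let $\varphi:\mathbb{R}^d\times\mathcal{E}\times\mathcal{E}\to[0,1]$ be measurable and symmetric, that is, $\varphi(-\bar x;b,a)=\varphi(\bar x;a,b)$. For $\lambda\ge 0$ let $\eta$ be a Poisson point process on $\mathbb{X}$ with intensity measure $\lambda\nu$. For $a\in\mathcal{E}$ let $o_a=(\bar 0,a)$, where $\bar 0$ is the origin of $\mathbb{R}^d$, and let $\xi^{o_a}$ be the random graph with vertex set $\eta\cup\{o_a\}$ in which, given $\eta$, each pair of distinct vertices $(\bar x,b),(\bar y,c)$ is joined by an edge with probability $\varphi(\bar x-\bar y;b,c)$, independently of all other pairs. Independently of everything else, give every vertex (including $o_a$) an independent label that is uniform on $(0,1)$; for $\gamma\in(0,1)$ let $\mathcal{G}$ be the set of vertices whose label is at most $\gamma$ (the ghost vertices), and let $\mathbb{P}_{\lambda,\gamma}$ be the resulting probability measure. Define the magnetization $$M(\lambda,\gamma,a):=\mathbb{P}_{\lambda,\gamma}\big(\text{the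 connected component of } o_a \text{ in } \xi^{o_a} \text{ contains a vertex of } \mathcal{G}\big).$$ **Lemma 3.4.** For all $\lambda\ge 0$ and $a\in\mathcal{E}$, the function $\gamma\mapsto M(\lambda,\gamma,a)$ is real-analytic on $(0,1)$. For all $\gamma\in(0,1)$ and $a\in\mathcal{E}$, the function $\lambda\mapsto M(\lambda,\gamma,a)$ is real-analytic on $(0,\infty)$. -/

import Mathlib

open MeasureTheory ProbabilityTheory unitInterval

/-!
The marked random connection model on `ℝ^d × E`.

The vertex set is a Poisson point process on `ℝ^d × E` whose intensity measure is `lam • ν`, where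
`ν = Leb ⊗ P`. It is built by the standard construction of a Poisson process with σ-finite intensity:
cut the space into the cells `(z + [0,1)^d) × E`, `z ∈ ℤ^d`, each of `ν`-mass one; independently over
the cells, put into the cell of `z` a Poisson(`lam`) number of points, which are independent with law
`ν` restricted to the cell.
-/

namespace RCM

/-- The space `𝕏 = ℝ^d × E` of marked points. -/
abbrev Pt (d : ℕ) (E : Type*) : Type _ := (Fin d → ℝ) × E

/-- The measure `ν = Leb ⊗ P` on `ℝ^d × E`. -/
noncomputable def nu (d : ℕ) {E : Type*} [MeasurableSpace E] (P : Measure E) : Measure (Pt d E) :=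
  (volume : Measure (Fin d → ℝ)).prod P

/-- The cell `(z + [0,1)^d) × E`. -/
def cell {d : ℕ} (E : Type*) (z : Fin d → ℤ) : Set (Pt d E) :=
  (Set.univ.pi fun i => Set.Ico (z i : ℝ) (z i + 1)) ×ˢ Set.univ

theorem nu_cell {d : ℕ} {E : Type*} [MeasurableSpace E] (P : Measure E) [IsProbabilityMeasure P]
    (z : Fin d → ℤ) : nu d P (cell E z) = 1 := by
  simp [nu, cell, Measure.prod_prod, volume_pi_pi]

/-- The law of a single point in the cell of `z`: the restriction of `ν` to the cell. -/
noncomputable def pointLaw {d : ℕ} {E : Type*} [MeasurableSpace E] (P : Measure E)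
    (z : Fin d → ℤ) : Measure (Pt d E) :=
  (nu d P).restrict (cell E z)

instance {d : ℕ} {E : Type*} [MeasurableSpace E] (P : Measure E) [IsProbabilityMeasure P]
    (z : Fin d → ℤ) : IsProbabilityMeasure (pointLaw P z) :=
  ⟨by rw [pointLaw, Measure.restrict_apply_univ, nu_cell]⟩

/-- Names of the potential Poisson points: `(z, k)` is the `k`-th point of the cell of `z`. -/
abbrev PIdx (d : ℕ) : Type := (Fin d → ℤ) × ℕ

/-- Names of the potential vertices of the augmented graph: `none` is the added vertex `o_a`,
`some (z, k)` is a potential Poisson point. -/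
abbrev VIdx (d : ℕ) : Type := Option (PIdx d)

/-- The sample space. `count z` is the number of Poisson points in the cell of `z`, `point (z, k)` is
the marked position of the `k`-th of them, `edge` carries a uniform variable for each unordered pair
of potential vertices, and `ghost` a uniform label for each potential vertex. -/
abbrev Omega (d : ℕ) (E : Type*) : Type _ :=
  ((Fin d → ℤ) → ℕ) × (PIdx d → Pt d E) × (Sym2 (VIdx d) → I) × (VIdx d → I)

namespace Omega

variable {d : ℕ} {E : Type*}

def count (w : Omega d E) : (Fin d → ℤ) → ℕ := w.1

def point (w : Omega d E) : PIdx d → Pt d E := w.2.1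

def edge (w : Omega d E) : Sym2 (VIdx d) → I := w.2.2.1

def ghost (w : Omega d E) : VIdx d → I := w.2.2.2

end Omega

/-- The probability measure `ℙ_{lam}` enriched with the ghost labels: all coordinates are independent,
the counts are Poisson(`lam`), the points have the law `ν` restricted to their cells, the edge
variables and the ghost labels are uniform on `[0,1]`. -/
noncomputable def prob (d : ℕ) {E : Type*} [MeasurableSpace E] (P : Measure E)
    [IsProbabilityMeasure P] (lam : ℝ) : Measure (Omega d E) :=
  (Measure.infinitePi fun _ : Fin d → ℤ => poissonMeasure lam.toNNReal).prod
    ((Measure.infinitePi fun v : PIdx d => pointLaw P v.1).prod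
      ((Measure.infinitePi fun _ : Sym2 (VIdx d) => (volume : Measure I)).prod
        (Measure.infinitePi fun _ : VIdx d => (volume : Measure I))))

instance (d : ℕ) {E : Type*} [MeasurableSpace E] (P : Measure E) [IsProbabilityMeasure P]
    (lam : ℝ) : IsProbabilityMeasure (prob d P lam) := by
  unfold prob; infer_instance

variable {d : ℕ} {E : Type*}

/-- The potential vertices that are vertices of `ξ^{o_a}`. -/
def Present (w : Omega d E) : VIdx d → Prop
  | none => True
  | some (z, k) => k < w.count z

/-- The marked position of a potential vertex; the added vertex is `o_a = (0, a)`. -/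
def loc (a : E) (w : Omega d E) : VIdx d → Pt d E
  | none => (0, a)
  | some v => w.point v

/-- The random graph `ξ^{o_a}`: two distinct vertices `x = (x̄, b)` and `y = (ȳ, c)` are joined when
their edge variable is at most `φ (x̄ - ȳ) b c`. -/
def graph (φ : (Fin d → ℝ) → E → E → I) (a : E) (w : Omega d E) : SimpleGraph (VIdx d) :=
  SimpleGraph.fromRel fun u v => Present w u ∧ Present w v ∧
    w.edge s(u, v) ≤ φ ((loc a w u).1 - (loc a w v).1) (loc a w u).2 (loc a w v).2

/-- The cluster `𝒞(o_a)` of the added vertex in `ξ^{o_a}`. -/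
def cluster (φ : (Fin d → ℝ) → E → E → I) (a : E) (w : Omega d E) : Set (VIdx d) :=
  {v | (graph φ a w).Reachable none v}

/-- The set `𝒢` of ghost vertices. -/
def ghosts (γ : ℝ) (w : Omega d E) : Set (VIdx d) :=
  {v | Present w v ∧ (w.ghost v : ℝ) ≤ γ}

/-- The magnetization `M(lam, γ, a) = ℙ_{lam, γ}(o_a ↔ 𝒢 in ξ^{o_a})`. -/
noncomputable def magnetization [MeasurableSpace E] (P : Measure E) [IsProbabilityMeasure P]
    (φ : (Fin d → ℝ) → E → E → I) (lam γ : ℝ) (a : E) : ℝ :=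
  (prob d P lam).real {w | (cluster φ a w ∩ ghosts γ w).Nonempty}

end RCM

/-!
The magnetization is one minus the probability that the cluster `𝒞` of `o_a` contains no ghost.
Integrating out the ghost labels first, an infinite cluster almost surely contains a ghost and a
cluster of `n` vertices avoids all ghosts with probability `(1 - γ) ^ n`, so that
`1 - M(lam, γ, a) = ∑ n, ℙ_lam(|𝒞| = n) (1 - γ) ^ n` (`magnetization_eq`). For fixed `lam` this is a
power series in `1 - γ` with coefficients in `[0, 1]`, hence analytic in `γ`.

For analyticity in `lam` the coefficients have to be continued to complex intensities with a good
bound. By the Mecke formula (`prob_cluster_encard`)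
`ℙ_lam(|𝒞| = n + 1) = lam ^ n / n! * ∫ G(x) exp (-lam * W(x)) dν^n(x)`,
where `G(x)` is the probability that `o_a, x 0, …, x (n - 1)` form a connected graph, and `W(x)` is
the `ν`-integral of the probability that a further point is joined to one of them. Thus the law of
the cluster size is `lam ^ n` times a Laplace transform in `lam`. It extends holomorphically to the
half-plane `0 < Re z`, where replacing the integrand by its modulus gives the bound
`(|z| / Re z) ^ n * ℙ_{Re z}(|𝒞| = n + 1) ≤ (|z| / Re z) ^ n` (`exists_continuation_prob_cluster`).
Therefore the series for `1 - M` converges geometrically on a sector `(1 - γ) |z| < r * Re z` with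
`1 - γ < r < 1`, which contains the positive half-line.

The Mecke formula is proved in the cell construction of the process. The event `|𝒞| = n + 1` is the
union over injective `n`-tuples of names `(z j, k j)`, each cluster being counted `n!` times, of the
events that `𝒞` consists of `o_a` and the named points. Given the cell counts `N`, such an event has
a probability that depends on the cells `z` only (`confLaw_cluster_eq_range`): the remaining
`N c - mult z c` points of each cell `c` independently have to avoid the cluster. Summing over the
labels `k` with the Mecke equation for Poisson counts (`tsum_lintegral_countLaw`) removes the shift
by `mult z` and produces the factor `lam ^ n`; what remains is the Poisson void probability
`exp (-lam * W(x))` (`lintegral_voidProd`).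
-/

open scoped ENNReal

namespace RCM

/-! ### Integrals against product measures -/

/-- Reindexing along an injection maps a product measure to a product measure. -/
theorem infinitePi_map_comp {ι κ X : Type*} [MeasurableSpace X] (μ : ι → Measure X)
    [∀ i, IsProbabilityMeasure (μ i)] {f : κ → ι} (hf : Function.Injective f) :
    (Measure.infinitePi μ).map (fun ω k => ω (f k)) = Measure.infinitePi fun k => μ (f k) := by
  classical
  refine Measure.eq_infinitePi _ fun s t ht => ?_
  rw [Measure.map_apply (by fun_prop) (MeasurableSet.pi s.countable_toSet fun i _ => ht i)]
  have h : (fun (ω : ι → X) k => ω (f k)) ⁻¹' (Set.pi s t) =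
      Set.pi (s.image f) (fun j => if h : ∃ k, f k = j then t h.choose else Set.univ) := by
    ext ω
    simp only [Set.mem_preimage, Set.mem_pi, Finset.mem_coe, Finset.mem_image]
    have key : ∀ k, (if h : ∃ k', f k' = f k then t h.choose else Set.univ) = t k := by
      intro k
      have h : ∃ k', f k' = f k := ⟨k, rfl⟩
      rw [dif_pos h, hf h.choose_spec]
    constructor
    · rintro h _ ⟨k, hk, rfl⟩
      rw [key]
      exact h k hk
    · intro h k hk
      have := h (f k) ⟨k, hk, rfl⟩
      rwa [key] at this
  rw [h, Measure.infinitePi_pi, Finset.prod_image fun a _ b _ h => hf h]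
  · refine Finset.prod_congr rfl fun k _ => ?_
    have h : ∃ k', f k' = f k := ⟨k, rfl⟩
    rw [dif_pos h, hf h.choose_spec]
  · intro j _
    split_ifs with h
    · exact ht _
    · exact MeasurableSet.univ

theorem lintegral_pi_prod {β X : Type*} [Fintype β] [MeasurableSpace X] (μ : β → Measure X)
    [∀ i, IsProbabilityMeasure (μ i)] (q : β → X → ℝ≥0∞) (hq : ∀ b, Measurable (q b)) :
    ∫⁻ y, ∏ b, q b (y b) ∂Measure.pi μ = ∏ b, ∫⁻ y, q b y ∂μ b := by
  have hind : iIndepFun (fun b (y : β → X) => q b (y b)) (Measure.pi μ) :=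
    iIndepFun_pi fun b => (hq b).aemeasurable
  rw [lintegral_prod_eq_prod_lintegral_of_indepFun _ _ hind fun b => by fun_prop]
  refine Finset.prod_congr rfl fun b _ => ?_
  exact (measurePreserving_eval μ b).lintegral_comp (hq b)

/-- Conditionally on the coordinates indexed by the range of `i`, the coordinates indexed by the
disjoint range of `t` are independent, so an integral of a product over them factorizes. -/
theorem lintegral_infinitePi_mul_prod {ι α β X : Type*} [Fintype α] [Fintype β]
    [MeasurableSpace X] (μ : ι → Measure X) [∀ i, IsProbabilityMeasure (μ i)]
    (i : α → ι) (t : β → ι) (hit : Function.Injective (Sum.elim i t))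
    (F : (α → X) → ℝ≥0∞) (hF : Measurable F) (q : β → (α → X) → X → ℝ≥0∞)
    (hq : ∀ b, Measurable (Function.uncurry (q b))) :
    ∫⁻ ω, F (fun a => ω (i a)) * ∏ b, q b (fun a => ω (i a)) (ω (t b)) ∂Measure.infinitePi μ =
      ∫⁻ x, F x * ∏ b, ∫⁻ y, q b x y ∂μ (t b) ∂Measure.pi fun a => μ (i a) := by
  have hq' : ∀ b (x : α → X), Measurable (q b x) := fun b x => (hq b).comp measurable_prodMk_left
  have hmeas : Measurable fun p : (α → X) × (β → X) => F p.1 * ∏ b, q b p.1 (p.2 b) := by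
    refine (hF.comp measurable_fst).mul (Finset.measurable_prod _ fun b _ => ?_)
    exact (hq b).comp (measurable_fst.prodMk ((measurable_pi_apply b).comp measurable_snd))
  have hmap := infinitePi_map_comp μ hit
  rw [Measure.infinitePi_eq_pi (μ := fun k => μ (Sum.elim i t k))] at hmap
  have hsum := measurePreserving_sumPiEquivProdPi fun k : α ⊕ β => μ (Sum.elim i t k)
  have h1 : MeasurePreserving (fun (ω : ι → X) k => ω (Sum.elim i t k)) (Measure.infinitePi μ)
      (Measure.pi fun k => μ (Sum.elim i t k)) := ⟨by fun_prop, hmap⟩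
  have h2 := (hsum.comp h1).lintegral_comp hmeas
  refine h2.trans ?_
  rw [lintegral_prod _ hmeas.aemeasurable]
  refine lintegral_congr fun x => ?_
  dsimp only
  rw [lintegral_const_mul]
  · congr 1
    exact lintegral_pi_prod (fun b => μ (t b)) (fun b => q b x) fun b => hq' b x
  · exact Finset.measurable_prod _ fun b _ => (hq' b x).comp (measurable_pi_apply b)

/-! ### Poisson distributions -/

theorem lintegral_poissonMeasure (r : NNReal) (f : ℕ → ℝ≥0∞) :
    ∫⁻ n, f n ∂poissonMeasure r =
      ∑' n, ENNReal.ofReal (Real.exp (-r) * r ^ n / n.factorial) * f n := by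
  rw [lintegral_countable']
  simp_rw [poissonMeasure_singleton, mul_comm]

/-- The Stein–Chen identity for a Poisson variable. The truncated `n - 1` at `n = 0` is harmless,
since it comes with the factor `0`. -/
theorem lintegral_poissonMeasure_mul (r : NNReal) (f : ℕ → ℝ≥0∞) :
    ∫⁻ n, n * f (n - 1) ∂poissonMeasure r = r * ∫⁻ n, f n ∂poissonMeasure r := by
  rw [lintegral_poissonMeasure, lintegral_poissonMeasure, tsum_eq_zero_add' ENNReal.summable,
    ← ENNReal.tsum_mul_left]
  simp only [Nat.cast_zero, zero_mul, mul_zero, zero_add, Nat.add_sub_cancel]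
  refine tsum_congr fun n => ?_
  rw [← mul_assoc, ← mul_assoc, ← ENNReal.ofReal_natCast, ← ENNReal.ofReal_coe_nnreal,
    ← ENNReal.ofReal_mul (by positivity), ← ENNReal.ofReal_mul (by positivity)]
  congr 2
  rw [Nat.factorial_succ]
  push_cast
  field_simp
  ring

theorem lintegral_poissonMeasure_pow (r : NNReal) {q : ℝ} (hq : 0 ≤ q) :
    ∫⁻ n, ENNReal.ofReal q ^ n ∂poissonMeasure r = ENNReal.ofReal (Real.exp (-(r * (1 - q)))) := by
  rw [lintegral_poissonMeasure]
  have hs : HasSum (fun n : ℕ => Real.exp (-r) * r ^ n / n.factorial * q ^ n)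
      (Real.exp (-(r * (1 - q)))) := by
    convert! (NormedSpace.expSeries_div_hasSum_exp ((r : ℝ) * q)).mul_left (Real.exp (-r)) using 1
    · ext n
      rw [mul_pow]
      ring
    · rw [← Real.exp_eq_exp_ℝ, ← Real.exp_add]
      ring_nf
  rw [← hs.tsum_eq, ENNReal.ofReal_tsum_of_nonneg (fun n => by positivity) hs.summable]
  refine tsum_congr fun n => ?_
  rw [← ENNReal.ofReal_pow hq, ← ENNReal.ofReal_mul (by positivity)]

/-- The joint law of independent Poisson counts with the common rate `r`. -/
noncomputable abbrev countLaw (κ : Type*) (r : NNReal) : Measure (κ → ℕ) :=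
  Measure.infinitePi fun _ : κ => poissonMeasure r

theorem lintegral_infinitePi_finset_prod {ι X : Type*} [MeasurableSpace X] (μ : ι → Measure X)
    [∀ i, IsProbabilityMeasure (μ i)] (s : Finset ι) (q : ι → X → ℝ≥0∞)
    (hq : ∀ b, Measurable (q b)) :
    ∫⁻ ω, ∏ b ∈ s, q b (ω b) ∂Measure.infinitePi μ = ∏ b ∈ s, ∫⁻ y, q b y ∂μ b := by
  have h := lintegral_infinitePi_mul_prod μ (Empty.elim) (fun b : s => (b : ι))
    (fun a b h => by
      rcases a with a | a
      · exact a.elim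
      rcases b with b | b
      · exact b.elim
      exact congrArg _ (Subtype.ext h))
    (fun _ => 1) measurable_const (fun b _ y => q b y) (fun b => (hq b).comp measurable_snd)
  simp only [one_mul, lintegral_const, measure_univ, mul_one] at h
  rw [Finset.prod_coe_sort s fun b => ∫⁻ y, q b y ∂μ b] at h
  rw [← h]
  exact lintegral_congr fun ω => (Finset.prod_coe_sort s fun b => q b (ω b)).symm

/-- One-point Mecke equation for the counts: size-biasing the count of a cell and then removing a
point from that cell multiplies the law of the counts by the intensity. -/
theorem lintegral_countLaw_mecke {κ : Type*} [DecidableEq κ] {r : NNReal} (hr : r ≠ 0) (c : κ)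
    (f : (κ → ℕ) → ℝ≥0∞) (hf : Measurable f) :
    ∫⁻ N, N c * f (N - Pi.single c 1) ∂countLaw κ r = r * ∫⁻ N, f N ∂countLaw κ r := by
  have hm : Measurable fun N : κ → ℕ => (N c : ℝ≥0∞) :=
    (measurable_of_countable (fun n : ℕ => (n : ℝ≥0∞))).comp (measurable_pi_apply c)
  have hsub : Measurable fun N : κ → ℕ => N - Pi.single c 1 :=
    measurable_pi_lambda _ fun b =>
      (measurable_of_countable fun n : ℕ => n - (Pi.single c 1 : κ → ℕ) b).comp
        (measurable_pi_apply b)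
  -- Both sides are integrals of `f`; it suffices to identify the measure `ρ` on boxes.
  set ρ : Measure (κ → ℕ) :=
    ((countLaw κ r).withDensity fun N => (N c : ℝ≥0∞)).map fun N => N - Pi.single c 1 with hρ
  have hρf : ∀ g : (κ → ℕ) → ℝ≥0∞, Measurable g →
      ∫⁻ N, g N ∂ρ = ∫⁻ N, N c * g (N - Pi.single c 1) ∂countLaw κ r := by
    intro g hg
    rw [hρ, lintegral_map hg hsub]
    exact lintegral_withDensity_eq_lintegral_mul _ hm (hg.comp hsub)
  have hbox : ∀ (s : Finset κ) (t : κ → Set ℕ), c ∈ s →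
      ρ (Set.pi s t) = r * ∏ i ∈ s, poissonMeasure r (t i) := by
    intro s t hc
    have hms : MeasurableSet (Set.pi (s : Set κ) t) :=
      MeasurableSet.pi s.countable_toSet fun i _ => MeasurableSet.of_discrete
    rw [← lintegral_indicator_one hms, hρf _ (measurable_one.indicator hms)]
    set q : κ → ℕ → ℝ≥0∞ := fun b n =>
      if b = c then n * (t c).indicator 1 (n - 1) else (t b).indicator 1 n with hq
    have h1 : ∀ N : κ → ℕ, (N c : ℝ≥0∞) * (Set.pi (s : Set κ) t).indicator 1 (N - Pi.single c 1) =
        ∏ b ∈ s, q b (N b) := by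
      intro N
      rw [← Finset.mul_prod_erase s _ hc]
      have h2 : ∏ b ∈ s.erase c, q b (N b) = ∏ b ∈ s.erase c, (t b).indicator 1 (N b) :=
        Finset.prod_congr rfl fun b hb => by simp [hq, Finset.ne_of_mem_erase hb]
      have h3 : (Set.pi (s : Set κ) t).indicator (1 : (κ → ℕ) → ℝ≥0∞) (N - Pi.single c 1) =
          ∏ b ∈ s, (t b).indicator 1 ((N - Pi.single c 1 : κ → ℕ) b) := by
        by_cases h : (N - Pi.single c 1 : κ → ℕ) ∈ Set.pi (s : Set κ) t
        · rw [Set.indicator_of_mem h, Finset.prod_eq_one]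
          · rfl
          · intro b hb
            rw [Set.indicator_of_mem (h b hb)]
            rfl
        · rw [Set.indicator_of_notMem h]
          simp only [Set.mem_pi, not_forall] at h
          obtain ⟨b, hb, hb'⟩ := h
          rw [Finset.prod_eq_zero hb (Set.indicator_of_notMem hb' _)]
      rw [h2, h3, ← Finset.mul_prod_erase s _ hc, ← mul_assoc]
      congr 1
      · simp [hq]
      · refine Finset.prod_congr rfl fun b hb => ?_
        simp [Pi.single_eq_of_ne (Finset.ne_of_mem_erase hb)]
    simp_rw [h1]
    rw [lintegral_infinitePi_finset_prod _ _ _ fun b => measurable_of_countable _,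
      ← Finset.mul_prod_erase s _ hc, ← Finset.mul_prod_erase s _ hc, ← mul_assoc]
    congr 1
    · simp only [hq, if_true]
      rw [lintegral_poissonMeasure_mul, lintegral_indicator_one MeasurableSet.of_discrete]
    · refine Finset.prod_congr rfl fun b hb => ?_
      simp only [hq, if_neg (Finset.ne_of_mem_erase hb)]
      rw [lintegral_indicator_one MeasurableSet.of_discrete]
  have hr0 : (r : ℝ≥0∞) ≠ 0 := by simpa using hr
  -- A box that does not constrain the cell `c` is first written as one that does.
  have heq : (r : ℝ≥0∞)⁻¹ • ρ = countLaw κ r := by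
    refine Measure.eq_infinitePi _ fun s t _ => ?_
    have h1 : Set.pi (s : Set κ) t =
        Set.pi (insert c s : Finset κ) fun b => if b ∈ s then t b else Set.univ := by
      ext N
      simp only [Set.mem_pi, Finset.mem_coe, Finset.mem_insert]
      refine ⟨fun h b _ => ?_, fun h b hb => by simpa [hb] using h b (Or.inr hb)⟩
      split_ifs with hb
      · exact h b hb
      · trivial
    rw [Measure.smul_apply, h1, hbox _ _ (Finset.mem_insert_self c s), smul_eq_mul, ← mul_assoc,
      ENNReal.inv_mul_cancel hr0 ENNReal.coe_ne_top, one_mul]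
    symm
    rw [← Finset.prod_subset (Finset.subset_insert c s)]
    · exact Finset.prod_congr rfl fun b hb => by rw [if_pos hb]
    · intro b _ hb
      rw [if_neg hb, measure_univ]
  rw [← hρf f hf, ← heq, lintegral_smul_measure, smul_eq_mul, ← mul_assoc,
    ENNReal.mul_inv_cancel hr0 ENNReal.coe_ne_top, one_mul]

/-! ### Mecke equation and void probability for Poisson counts -/

/-- The number of entries of the tuple `z` that are equal to `c`. -/
def mult {κ : Type*} [DecidableEq κ] {n : ℕ} (z : Fin n → κ) (c : κ) : ℕ :=
  (Finset.univ.filter fun j => z j = c).card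

theorem mult_cons {κ : Type*} [DecidableEq κ] {n : ℕ} (c : κ) (z : Fin n → κ) :
    mult (Fin.cons c z : Fin (n + 1) → κ) = mult z + Pi.single c 1 := by
  ext b
  simp only [mult, Pi.add_apply, Finset.card_filter, Fin.sum_univ_succ, Fin.cons_zero,
    Fin.cons_succ, Pi.single_apply, eq_comm (a := b)]
  exact add_comm _ _

/-- The names `(z j, k j)` are distinct and name points that are present when the counts are `N`. -/
def IsAdmissible {κ : Type*} {n : ℕ} (z : Fin n → κ) (k : Fin n → ℕ) (N : κ → ℕ) : Prop :=
  (∀ j, k j < N (z j)) ∧ Function.Injective fun j => (z j, k j)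

/-- The labels of the present points of the cell `c` whose names are not among the `(z j, k j)`. -/
def free {κ : Type*} [DecidableEq κ] {n : ℕ} (z : Fin n → κ) (k : Fin n → ℕ) (N : κ → ℕ) (c : κ) :
    Finset ℕ :=
  (Finset.range (N c)).filter fun m => ∀ j, (z j, k j) ≠ (c, m)

theorem card_free {κ : Type*} [DecidableEq κ] {n : ℕ} {z : Fin n → κ} {k : Fin n → ℕ}
    {N : κ → ℕ} (h : IsAdmissible z k N) (c : κ) : (free z k N c).card = N c - mult z c := by
  have h1 : free z k N c =
      Finset.range (N c) \ (Finset.univ.filter fun j => z j = c).image k := by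
    ext m
    simp only [free, Finset.mem_filter, Finset.mem_range, Finset.mem_sdiff, Finset.mem_image,
      Finset.mem_univ, true_and, not_exists, not_and, ne_eq, Prod.mk.injEq]
  have h2 : (Finset.univ.filter fun j => z j = c).image k ⊆ Finset.range (N c) := by
    intro m hm
    obtain ⟨j, hj, rfl⟩ := Finset.mem_image.1 hm
    have := (Finset.mem_filter.1 hj).2
    exact Finset.mem_range.2 (this ▸ h.1 j)
  rw [h1, Finset.card_sdiff_of_subset h2, Finset.card_range, Finset.card_image_of_injOn, mult]
  intro i hi j hj hij
  have hi' : z i = c := by simpa using hi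
  have hj' : z j = c := by simpa using hj
  exact h.2 (Prod.ext (hi'.trans hj'.symm) hij)

theorem isAdmissible_cons {κ : Type*} [DecidableEq κ] {n : ℕ} {c : κ} {z : Fin n → κ} {m : ℕ}
    {k : Fin n → ℕ} {N : κ → ℕ} :
    IsAdmissible (Fin.cons c z : Fin (n + 1) → κ) (Fin.cons m k : Fin (n + 1) → ℕ) N ↔
      IsAdmissible z k N ∧ m ∈ free z k N c := by
  have h : (fun j => ((Fin.cons c z : Fin (n + 1) → κ) j, (Fin.cons m k : Fin (n + 1) → ℕ) j)) =
      (Fin.cons (c, m) fun j => (z j, k j) : Fin (n + 1) → κ × ℕ) := by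
    ext j <;> refine Fin.cases ?_ (fun j => ?_) j <;> rfl
  rw [IsAdmissible, h, Fin.cons_injective_iff, Fin.forall_fin_succ]
  simp only [IsAdmissible, free, Fin.cons_zero, Fin.cons_succ, Finset.mem_filter,
    Finset.mem_range, Set.mem_range, not_exists, ne_eq]
  tauto

theorem measurableSet_isAdmissible {κ : Type*} {n : ℕ} (z : Fin n → κ) (k : Fin n → ℕ) :
    MeasurableSet {N : κ → ℕ | IsAdmissible z k N} := by
  have h : {N : κ → ℕ | IsAdmissible z k N} = (⋂ j, (fun N => N (z j)) ⁻¹' Set.Ioi (k j)) ∩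
      {_N | Function.Injective fun j => (z j, k j)} := by
    ext N
    simp [IsAdmissible]
  rw [h]
  exact (MeasurableSet.iInter fun j =>
    measurable_pi_apply (z j) (MeasurableSet.of_discrete (s := Set.Ioi (k j)))).inter
      (MeasurableSet.const _)

theorem measurable_sub_mult {κ : Type*} (a : κ → ℕ) :
    Measurable fun N : κ → ℕ => N - a :=
  measurable_pi_lambda _ fun b =>
    (measurable_of_countable fun n : ℕ => n - a b).comp (measurable_pi_apply b)

open scoped Classical in
/-- Multivariate Mecke equation for the counts: summing over all admissible choices of the labels `k`
and deleting the chosen points amounts to multiplication by `r ^ n`. The truncated subtraction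
`N - mult z` is a true one, as admissibility forces `mult z ≤ N`. -/
theorem tsum_lintegral_countLaw {κ : Type*} [DecidableEq κ] {r : NNReal} (hr : r ≠ 0) {n : ℕ}
    (z : Fin n → κ) (f : (κ → ℕ) → ℝ≥0∞) (hf : Measurable f) :
    ∑' k : Fin n → ℕ, ∫⁻ N, (if IsAdmissible z k N then f (N - mult z) else 0) ∂countLaw κ r =
      r ^ n * ∫⁻ N, f N ∂countLaw κ r := by
  induction n generalizing f with
  | zero =>
    rw [tsum_eq_single default fun k hk => absurd (Subsingleton.elim _ _) hk, pow_zero, one_mul]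
    refine lintegral_congr fun N => ?_
    rw [if_pos ⟨fun j => j.elim0, fun j => j.elim0⟩]
    congr 1
  | succ n ih =>
    obtain ⟨c, z, rfl⟩ : ∃ c z', z = Fin.cons c z' := ⟨_, _, (Fin.cons_self_tail z).symm⟩
    have hg : Measurable fun N : κ → ℕ => (N c : ℝ≥0∞) * f (N - Pi.single c 1) :=
      ((measurable_of_countable (fun n : ℕ => (n : ℝ≥0∞))).comp (measurable_pi_apply c)).mul
        (hf.comp (measurable_sub_mult _))
    rw [pow_succ, mul_assoc, ← lintegral_countLaw_mecke hr c f hf, ← ih z _ hg,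
      ← (Fin.consEquiv fun _ => ℕ).tsum_eq, ENNReal.tsum_prod', ENNReal.tsum_comm]
    refine tsum_congr fun k => ?_
    rw [← lintegral_tsum]
    · refine lintegral_congr fun N => ?_
      simp only [Fin.consEquiv, Equiv.coe_fn_mk, isAdmissible_cons]
      by_cases h : IsAdmissible z k N
      · simp only [h, true_and, if_true]
        rw [tsum_eq_sum (s := free z k N c) fun m hm => if_neg hm,
          Finset.sum_congr rfl fun m hm => if_pos hm, Finset.sum_const, card_free h, mult_cons,
          nsmul_eq_mul, tsub_add_eq_tsub_tsub]
        rfl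
      · simp [h]
    · intro m
      refine Measurable.aemeasurable (Measurable.ite (measurableSet_isAdmissible _ _) ?_
        measurable_const)
      exact hf.comp (measurable_sub_mult _)

/-- `exp (-r W)`, with the value `0` at `W = ∞`. -/
noncomputable def expNeg (r : NNReal) (W : ℝ≥0∞) : ℝ≥0∞ :=
  if W = ∞ then 0 else ENNReal.ofReal (Real.exp (-(r * W.toReal)))

/-- Continuity from above of `expNeg`, including the divergent case, where the limit is `0`. -/
theorem iInf_expNeg_sum {κ : Type*} {r : NNReal} (hr : r ≠ 0) (w : κ → ℝ≥0∞) (hw : ∀ c, w c ≠ ∞) :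
    ⨅ s : Finset κ, expNeg r (∑ c ∈ s, w c) = expNeg r (∑' c, w c) := by
  have hr' : 0 < (r : ℝ) := by positivity
  have hfin : ∀ s : Finset κ, ∑ c ∈ s, w c ≠ ∞ := fun s => ENNReal.sum_ne_top.2 fun c _ => hw c
  have hanti : ∀ {a b : ℝ≥0∞}, a ≤ b → expNeg r b ≤ expNeg r a := by
    intro a b hab
    unfold expNeg
    by_cases hb : b = ∞
    · simp [hb]
    · rw [if_neg hb, if_neg (ne_top_of_le_ne_top hb hab)]
      have := ENNReal.toReal_mono hb hab
      gcongr
  refine le_antisymm ?_ (le_iInf fun s => hanti (ENNReal.sum_le_tsum s))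
  have hlim : Filter.Tendsto (fun s : Finset κ => ∑ c ∈ s, w c) Filter.atTop (nhds (∑' c, w c)) :=
    ENNReal.summable.hasSum
  by_cases hW : ∑' c, w c = ∞
  · have h0 : Filter.Tendsto
        (fun s : Finset κ => ENNReal.ofReal (Real.exp (-(r * (∑ c ∈ s, w c).toReal))))
        Filter.atTop (nhds (ENNReal.ofReal 0)) := by
      refine ENNReal.tendsto_ofReal (Real.tendsto_exp_neg_atTop_nhds_zero.comp ?_)
      refine Filter.Tendsto.const_mul_atTop hr' ?_
      rw [hW] at hlim
      rw [Filter.tendsto_atTop]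
      intro b
      filter_upwards [hlim (lt_mem_nhds (ENNReal.ofReal_lt_top (r := b)))] with s hs
      exact (ENNReal.ofReal_le_iff_le_toReal (hfin s)).1 (le_of_lt hs)
    rw [expNeg, if_pos hW, ← ENNReal.ofReal_zero]
    refine ge_of_tendsto' h0 fun s => (iInf_le _ s).trans ?_
    rw [expNeg, if_neg (hfin s)]
  · have h0 : Filter.Tendsto
        (fun s : Finset κ => ENNReal.ofReal (Real.exp (-(r * (∑ c ∈ s, w c).toReal))))
        Filter.atTop (nhds (ENNReal.ofReal (Real.exp (-(r * (∑' c, w c).toReal))))) := by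
      refine ENNReal.tendsto_ofReal ((Real.continuous_exp.tendsto _).comp ?_)
      exact (((ENNReal.tendsto_toReal hW).comp hlim).const_mul _).neg
    conv_rhs => rw [expNeg, if_neg hW]
    refine ge_of_tendsto' h0 fun s => (iInf_le _ s).trans ?_
    rw [expNeg, if_neg (hfin s)]

/-- The probability that independent thinning with retention probabilities `1 - q c` removes all
points, given the counts `N`: the infinite product of the `q c ^ N c`, written as the infimum of the
finite products, which decrease when `q ≤ 1`. -/
noncomputable def voidProd {κ : Type*} (q : κ → ℝ≥0∞) (N : κ → ℕ) : ℝ≥0∞ :=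
  ⨅ s : Finset κ, ∏ c ∈ s, q c ^ N c

theorem measurable_voidProd {κ Y : Type*} [Countable κ] [MeasurableSpace Y] {q : Y → κ → ℝ≥0∞}
    (hq : ∀ c, Measurable fun y => q y c) :
    Measurable fun p : Y × (κ → ℕ) => voidProd (q p.1) p.2 := by
  refine Measurable.iInf fun s => Finset.measurable_prod _ fun c _ => ?_
  have h : Measurable fun p : ℝ≥0∞ × ℕ => p.1 ^ p.2 :=
    measurable_from_prod_countable_left fun n => measurable_id.pow_const n
  exact h.comp (((hq c).comp measurable_fst).prodMk
    ((measurable_pi_apply c).comp measurable_snd))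

theorem measurable_voidProd_right {κ : Type*} [Countable κ] (q : κ → ℝ≥0∞) :
    Measurable (voidProd q) :=
  Measurable.iInf fun s => Finset.measurable_prod s fun c _ =>
    (measurable_of_countable fun n : ℕ => q c ^ n).comp (measurable_pi_apply c)

theorem directed_finset_prod {κ Y : Type*} {q : κ → Y → ℝ≥0∞} (hq : ∀ c y, q c y ≤ 1) :
    Directed (· ≥ ·) fun (s : Finset κ) (y : Y) => ∏ c ∈ s, q c y := by
  classical
  refine directed_of_isDirected_le fun s t hst y => ?_
  exact Finset.prod_le_prod_of_subset_of_le_one' hst fun c _ _ => hq c y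

/-- Void probability of a thinned Poisson process. -/
theorem lintegral_voidProd {κ : Type*} [Countable κ] {r : NNReal} (hr : r ≠ 0) {q : κ → ℝ≥0∞}
    (hq : ∀ c, q c ≤ 1) :
    ∫⁻ N, voidProd q N ∂countLaw κ r = expNeg r (∑' c, (1 - q c)) := by
  have hqm : ∀ c, Measurable fun n : ℕ => q c ^ n := fun c => measurable_of_countable _
  unfold voidProd
  have hle : ∀ c (N : κ → ℕ), q c ^ N c ≤ 1 := fun c N => pow_le_one' (hq c) _
  have hint : ∀ s : Finset κ, ∫⁻ N : κ → ℕ, ∏ c ∈ s, q c ^ N c ∂countLaw κ r =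
      expNeg r (∑ c ∈ s, (1 - q c)) := by
    intro s
    rw [lintegral_infinitePi_finset_prod _ s (fun c n => q c ^ n) hqm]
    have hs : ∑ c ∈ s, (1 - q c) ≠ ∞ := ENNReal.sum_ne_top.2 fun c _ => by simp
    rw [expNeg, if_neg hs, ENNReal.toReal_sum (fun c _ => by simp), Finset.mul_sum,
      ← Finset.sum_neg_distrib, Real.exp_sum, ENNReal.ofReal_prod_of_nonneg fun c _ => by positivity]
    refine Finset.prod_congr rfl fun c _ => ?_
    have hc : q c ≠ ∞ := ne_top_of_le_ne_top ENNReal.one_ne_top (hq c)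
    have := lintegral_poissonMeasure_pow r (q := (q c).toReal) ENNReal.toReal_nonneg
    rw [ENNReal.ofReal_toReal hc] at this
    rw [this, ENNReal.toReal_sub_of_le (hq c) ENNReal.one_ne_top, ENNReal.toReal_one]
  rw [lintegral_iInf_directed_of_measurable]
  · simp_rw [hint]
    exact iInf_expNeg_sum hr _ fun c => by simp
  · exact IsProbabilityMeasure.ne_zero _
  · exact fun s => Finset.measurable_prod _ fun c _ => (hqm c).comp (measurable_pi_apply c)
  · intro s
    rw [hint, expNeg]
    split_ifs <;> simp
  · exact directed_finset_prod hle

section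

/-! ### Clusters as images of finite tuples -/

/-- The connected component of `f o` is the range of `f` exactly when the graph is connected on that
range and no edge leaves it. -/
theorem setOf_reachable_eq_range_iff {V W : Type*} (G : SimpleGraph V) {f : W → V}
    (hf : Function.Injective f) (o : W) :
    {v | G.Reachable (f o) v} = Set.range f ↔
      (∀ u, (G.comap f).Reachable o u) ∧ ∀ u v, v ∉ Set.range f → ¬ G.Adj (f u) v := by
  have hlift : ∀ u, (G.comap f).Reachable o u → G.Reachable (f o) (f u) := fun u h =>
    h.map (SimpleGraph.Hom.comap f G)
  constructor
  · intro h
    have hmem : ∀ v, G.Reachable (f o) v ↔ v ∈ Set.range f := fun v => by rw [← h]; rfl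
    have key : ∀ v, G.Reachable (f o) v → ∃ u, f u = v ∧ (G.comap f).Reachable o u := by
      intro v hv
      rw [SimpleGraph.reachable_iff_reflTransGen] at hv
      induction hv with
      | refl => exact ⟨o, rfl, SimpleGraph.Reachable.refl o⟩
      | @tail b c hb hbc ih =>
        obtain ⟨u, rfl, hu⟩ := ih
        have hc : G.Reachable (f o) c := by
          rw [SimpleGraph.reachable_iff_reflTransGen]
          exact hb.tail hbc
        obtain ⟨u', rfl⟩ := (hmem c).1 hc
        exact ⟨u', rfl, hu.trans (SimpleGraph.Adj.reachable hbc)⟩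
    refine ⟨fun u => ?_, fun u v hv huv => hv ?_⟩
    · obtain ⟨u', hu', h'⟩ := key (f u) ((hmem _).2 ⟨u, rfl⟩)
      exact hf hu' ▸ h'
    · exact (hmem v).1 (((hmem _).2 ⟨u, rfl⟩).trans huv.reachable)
  · rintro ⟨h1, h2⟩
    refine Set.Subset.antisymm (fun v hv => ?_) ?_
    · have hv' : G.Reachable (f o) v := hv
      rw [SimpleGraph.reachable_iff_reflTransGen] at hv'
      induction hv' with
      | refl => exact ⟨o, rfl⟩
      | @tail b c hb hbc ih =>
        obtain ⟨u, rfl⟩ := ih ((SimpleGraph.reachable_iff_reflTransGen _ _).2 hb)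
        by_contra hc
        exact h2 u c hc hbc
    · rintro _ ⟨u, rfl⟩
      exact hlift u (h1 u)

variable {d : ℕ} {E : Type*}

/-- The connection probability of two marked points. -/
def conn (φ : (Fin d → ℝ) → E → E → I) (p q : Pt d E) : I := φ (p.1 - q.1) p.2 q.2

/-- The graph on `V` in which `u` and `v` are joined when the edge variable `e s(u, v)` is at most the
connection probability of their positions `x u` and `x v`; all elements of `V` are vertices. -/
def posGraph {V : Type*} (φ : (Fin d → ℝ) → E → E → I) (x : V → Pt d E) (e : Sym2 V → I) :
    SimpleGraph V :=
  SimpleGraph.fromRel fun u v => e s(u, v) ≤ conn φ (x u) (x v)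

theorem conn_comm {φ : (Fin d → ℝ) → E → E → I} (hφ : ∀ x b c, φ (-x) c b = φ x b c)
    (p q : Pt d E) : conn φ p q = conn φ q p := by
  rw [conn, conn, ← neg_sub, hφ]

theorem posGraph_adj {V : Type*} {φ : (Fin d → ℝ) → E → E → I}
    (hφ : ∀ x b c, φ (-x) c b = φ x b c) {x : V → Pt d E} {e : Sym2 V → I} {u v : V} :
    (posGraph φ x e).Adj u v ↔ u ≠ v ∧ e s(u, v) ≤ conn φ (x u) (x v) := by
  rw [posGraph, SimpleGraph.fromRel_adj, Sym2.eq_swap (a := v), conn_comm hφ (x v), or_self]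

theorem graph_adj {φ : (Fin d → ℝ) → E → E → I} (hφ : ∀ x b c, φ (-x) c b = φ x b c)
    {a : E} {w : Omega d E} {u v : VIdx d} :
    (graph φ a w).Adj u v ↔
      u ≠ v ∧ Present w u ∧ Present w v ∧ w.edge s(u, v) ≤ conn φ (loc a w u) (loc a w v) := by
  have h := conn_comm hφ (loc a w u) (loc a w v)
  rw [graph, SimpleGraph.fromRel_adj, Sym2.eq_swap (a := v)]
  simp only [conn] at h ⊢
  rw [← h]
  tauto

/-- The positions of the added vertex and of the points `x`. -/
def root {n : ℕ} (a : E) (x : Fin n → Pt d E) : Option (Fin n) → Pt d E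
  | none => (0, a)
  | some j => x j

theorem mem_range_optionMap {α β : Type*} {i : α → β} {b : β} :
    some b ∈ Set.range (Option.map i) ↔ b ∈ Set.range i := by
  constructor
  · rintro ⟨_ | j, h⟩
    · simp at h
    · exact ⟨j, by simpa using h⟩
  · rintro ⟨j, rfl⟩
    exact ⟨some j, rfl⟩

/-- The vertices `none, i 0, …, i (n - 1)` are connected to `none` among themselves. -/
def InnerConnected {n : ℕ} (φ : (Fin d → ℝ) → E → E → I) (a : E) (x : Fin n → Pt d E)
    (e : Sym2 (Option (Fin n)) → I) : Prop :=
  ∀ u, (posGraph φ (root a x) e).Reachable none u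

open scoped Classical in
/-- The event that the cluster consists of the added vertex and the points named `(z j, k j)`, in
terms of disjoint groups of coordinates: those of the named points, and those of each other point. -/
theorem cluster_eq_range_iff {φ : (Fin d → ℝ) → E → E → I} (hφ : ∀ x b c, φ (-x) c b = φ x b c)
    {a : E} {w : Omega d E} {n : ℕ} {z : Fin n → Fin d → ℤ} {k : Fin n → ℕ}
    (h : IsAdmissible z k w.count) :
    cluster φ a w = Set.range (Option.map fun j => (z j, k j)) ↔
      InnerConnected φ a (fun j => w.point (z j, k j))
          (fun s => w.edge (s.map (Option.map fun j => (z j, k j)))) ∧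
        ∀ c, ∀ m ∈ free z k w.count c, ∀ u : Option (Fin n),
          ¬ w.edge s(some (c, m), u.map fun j => (z j, k j)) ≤
            conn φ (w.point (c, m)) (root a (fun j => w.point (z j, k j)) u) := by
  set f : Option (Fin n) → VIdx d := Option.map fun j => (z j, k j) with hf
  have hfinj : Function.Injective f := Option.map_injective h.2
  have hpres : ∀ u, Present w (f u) := by
    rintro (_ | j)
    · trivial
    · exact h.1 j
  have hloc : ∀ u, loc a w (f u) = root a (fun j => w.point (z j, k j)) u := by
    rintro (_ | j) <;> rfl
  have hcomap : (graph φ a w).comap f = posGraph φ (root a fun j => w.point (z j, k j))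
      (fun s => w.edge (s.map f)) := by
    ext u v
    rw [SimpleGraph.comap_adj, graph_adj hφ, posGraph_adj hφ, hloc, hloc]
    simp [hpres, hfinj.ne_iff, Sym2.map_mk]
  have h1 := setOf_reachable_eq_range_iff (graph φ a w) hfinj none
  rw [hcomap] at h1
  refine h1.trans (and_congr Iff.rfl ⟨fun H c m hm u hle => ?_, fun H u v hv huv => ?_⟩)
  · obtain ⟨hm1, hm2⟩ := Finset.mem_filter.1 hm
    have hnr : some (c, m) ∉ Set.range f := by
      rw [hf, mem_range_optionMap]
      rintro ⟨j, hj⟩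
      exact hm2 j hj
    refine H u (some (c, m)) hnr ?_
    rw [graph_adj hφ]
    refine ⟨fun he => hnr ⟨u, he⟩, hpres u, Finset.mem_range.1 hm1, ?_⟩
    rw [Sym2.eq_swap, conn_comm hφ, hloc]
    exact hle
  · rw [graph_adj hφ] at huv
    obtain ⟨-, -, hp, hle⟩ := huv
    rcases v with _ | ⟨c, m⟩
    · exact hv ⟨none, rfl⟩
    · refine H c m (Finset.mem_filter.2 ⟨Finset.mem_range.2 hp, fun j hj => hv ?_⟩) u ?_
      · rw [hf, mem_range_optionMap]
        exact ⟨j, hj⟩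
      · rw [Sym2.eq_swap, conn_comm hφ, hloc] at hle
        exact hle

theorem present_of_mem_cluster {φ : (Fin d → ℝ) → E → E → I}
    (hφ : ∀ x b c, φ (-x) c b = φ x b c) {a : E} {w : Omega d E} {v : VIdx d}
    (hv : v ∈ cluster φ a w) : Present w v := by
  have hv' : (graph φ a w).Reachable none v := hv
  rw [SimpleGraph.reachable_iff_reflTransGen] at hv'
  cases hv' with
  | refl => trivial
  | tail _ h => exact ((graph_adj hφ).1 h).2.2.1

theorem none_mem_cluster {φ : (Fin d → ℝ) → E → E → I} {a : E} {w : Omega d E} :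
    none ∈ cluster φ a w :=
  SimpleGraph.Reachable.refl _

/-- Reachability is a countable union, over the length of a walk and its vertices, of adjacency
events. -/
theorem measurableSet_reachable {Ω V : Type*} [MeasurableSpace Ω] [Countable V]
    (G : Ω → SimpleGraph V) (hG : ∀ u v, MeasurableSet {ω | (G ω).Adj u v}) (u v : V) :
    MeasurableSet {ω | (G ω).Reachable u v} := by
  have key : ∀ (n : ℕ) (u : V), MeasurableSet {ω | ∃ p : (G ω).Walk u v, p.length = n} := by
    intro n
    induction n with
    | zero =>
      intro u
      simp only [SimpleGraph.Walk.exists_length_eq_zero_iff]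
      exact MeasurableSet.const _
    | succ n ih =>
      intro u
      have h : {ω | ∃ p : (G ω).Walk u v, p.length = n + 1} =
          ⋃ b, {ω | (G ω).Adj u b} ∩ {ω | ∃ p : (G ω).Walk b v, p.length = n} := by
        ext ω
        simp only [Set.mem_iUnion, Set.mem_inter_iff, Set.mem_ofPred_eq]
        constructor
        · rintro ⟨p, hp⟩
          cases p with
          | nil => simp at hp
          | cons h q => exact ⟨_, h, q, by simpa using hp⟩
        · rintro ⟨b, h, q, hq⟩
          exact ⟨SimpleGraph.Walk.cons h q, by simp [hq]⟩
      rw [h]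
      exact MeasurableSet.iUnion fun b => (hG u b).inter (ih b)
  have h : {ω | (G ω).Reachable u v} = ⋃ n, {ω | ∃ p : (G ω).Walk u v, p.length = n} := by
    ext ω
    simp only [Set.mem_iUnion, Set.mem_ofPred_eq]
    exact ⟨fun ⟨p⟩ => ⟨p.length, p, rfl⟩, fun ⟨_, p, _⟩ => ⟨p⟩⟩
  rw [h]
  exact MeasurableSet.iUnion fun n => key n u

variable [MeasurableSpace E]

theorem measurable_conn {φ : (Fin d → ℝ) → E → E → I}
    (hφ : Measurable fun p : (Fin d → ℝ) × E × E => φ p.1 p.2.1 p.2.2) :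
    Measurable fun p : Pt d E × Pt d E => conn φ p.1 p.2 := by
  have h : Measurable fun p : Pt d E × Pt d E => (p.1.1 - p.2.1, p.1.2, p.2.2) := by fun_prop
  exact hφ.comp h

theorem measurableSet_posGraph_adj {V Ω : Type*} [MeasurableSpace Ω] {φ : (Fin d → ℝ) → E → E → I}
    (hφ : Measurable fun p : (Fin d → ℝ) × E × E => φ p.1 p.2.1 p.2.2)
    (hφs : ∀ x b c, φ (-x) c b = φ x b c) {x : Ω → V → Pt d E} {e : Ω → Sym2 V → I}
    (hx : ∀ v, Measurable fun ω => x ω v) (he : ∀ s, Measurable fun ω => e ω s) (u v : V) :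
    MeasurableSet {ω | (posGraph φ (x ω) (e ω)).Adj u v} := by
  simp only [posGraph_adj hφs]
  exact (MeasurableSet.const _).inter
    (measurableSet_le (α := I) (he _) ((measurable_conn hφ).comp ((hx u).prodMk (hx v))))

theorem measurable_root {n : ℕ} (a : E) (u : Option (Fin n)) :
    Measurable fun x : Fin n → Pt d E => root a x u := by
  rcases u with _ | j
  · exact measurable_const
  · exact measurable_pi_apply j

theorem measurableSet_innerConnected {n : ℕ} {φ : (Fin d → ℝ) → E → E → I}
    (hφ : Measurable fun p : (Fin d → ℝ) × E × E => φ p.1 p.2.1 p.2.2)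
    (hφs : ∀ x b c, φ (-x) c b = φ x b c) (a : E) :
    MeasurableSet {p : (Fin n → Pt d E) × (Sym2 (Option (Fin n)) → I) |
      InnerConnected φ a p.1 p.2} := by
  have h : {p : (Fin n → Pt d E) × (Sym2 (Option (Fin n)) → I) | InnerConnected φ a p.1 p.2} =
      ⋂ u, {p | (posGraph φ (root a p.1) p.2).Reachable none u} := by
    ext p
    simp [InnerConnected]
  rw [h]
  refine MeasurableSet.iInter fun u => measurableSet_reachable _ (fun u v => ?_) _ _
  exact measurableSet_posGraph_adj hφ hφs
    (fun v => (measurable_root a v).comp measurable_fst) (fun s => by fun_prop) u v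

theorem measurableSet_present (v : VIdx d) : MeasurableSet {w : Omega d E | Present w v} := by
  rcases v with _ | ⟨c, m⟩
  · exact MeasurableSet.const _
  · exact ((measurable_pi_apply c).comp measurable_fst)
      (MeasurableSet.of_discrete (s := Set.Ioi m))

theorem measurable_loc (a : E) (v : VIdx d) : Measurable fun w : Omega d E => loc a w v := by
  rcases v with _ | v
  · exact measurable_const
  · exact (measurable_pi_apply v).comp (measurable_fst.comp measurable_snd)

theorem measurableSet_mem_cluster {φ : (Fin d → ℝ) → E → E → I}
    (hφ : Measurable fun p : (Fin d → ℝ) × E × E => φ p.1 p.2.1 p.2.2)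
    (hφs : ∀ x b c, φ (-x) c b = φ x b c) (a : E) (v : VIdx d) :
    MeasurableSet {w : Omega d E | v ∈ cluster φ a w} := by
  refine measurableSet_reachable _ (fun u v => ?_) _ _
  simp only [graph_adj hφs]
  refine (MeasurableSet.const _).inter ((measurableSet_present u).inter
    ((measurableSet_present v).inter (measurableSet_le (α := I) ?_ ?_)))
  · exact (measurable_pi_apply s(u, v)).comp
      (measurable_fst.comp (measurable_snd.comp measurable_snd))
  · exact (measurable_conn hφ).comp ((measurable_loc a u).prodMk (measurable_loc a v))

theorem measurableSet_cluster_eq {φ : (Fin d → ℝ) → E → E → I}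
    (hφ : Measurable fun p : (Fin d → ℝ) × E × E => φ p.1 p.2.1 p.2.2)
    (hφs : ∀ x b c, φ (-x) c b = φ x b c) (a : E) (S : Set (VIdx d)) :
    MeasurableSet {w : Omega d E | cluster φ a w = S} := by
  have h : {w : Omega d E | cluster φ a w = S} = ⋂ v, {w | v ∈ cluster φ a w ↔ v ∈ S} := by
    ext w
    simp [Set.ext_iff]
  rw [h]
  refine MeasurableSet.iInter fun v => ?_
  by_cases hv : v ∈ S
  · simpa [hv] using measurableSet_mem_cluster hφ hφs a v
  · simp only [hv, iff_false]
    exact (measurableSet_mem_cluster hφ hφs a v).compl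

end

/-! ### The law of the cluster given the counts -/

section

variable {d : ℕ} {E : Type*}

/-- The probability that the added vertex and the points `x` form a connected graph. -/
noncomputable def innerProb {n : ℕ} (φ : (Fin d → ℝ) → E → E → I) (a : E) (x : Fin n → Pt d E) :
    ℝ≥0∞ :=
  Measure.pi (fun _ : Sym2 (Option (Fin n)) => (volume : Measure I)) {e | InnerConnected φ a x e}

theorem innerProb_le_one {n : ℕ} (φ : (Fin d → ℝ) → E → E → I) (a : E) (x : Fin n → Pt d E) :
    innerProb φ a x ≤ 1 := prob_le_one

variable [MeasurableSpace E]

/-- The joint law of the point positions and the edge variables. -/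
noncomputable def confLaw (d : ℕ) {E : Type*} [MeasurableSpace E] (P : Measure E)
    [IsProbabilityMeasure P] : Measure ((PIdx d → Pt d E) × (Sym2 (VIdx d) → I)) :=
  (Measure.infinitePi fun v : PIdx d => pointLaw P v.1).prod
    (Measure.infinitePi fun _ : Sym2 (VIdx d) => (volume : Measure I))

instance (P : Measure E) [IsProbabilityMeasure P] : IsProbabilityMeasure (confLaw d P) := by
  unfold confLaw; infer_instance

/-- The probability that a random point of the cell `c` is joined neither to the added vertex nor
to one of the points `x`. -/
noncomputable def avoidProb {n : ℕ} (P : Measure E) (φ : (Fin d → ℝ) → E → E → I) (a : E)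
    (x : Fin n → Pt d E) (c : Fin d → ℤ) : ℝ≥0∞ :=
  ∫⁻ y, ∏ u, ENNReal.ofReal (1 - conn φ y (root a x u)) ∂pointLaw P c

theorem avoidProb_le_one {n : ℕ} (P : Measure E) [IsProbabilityMeasure P]
    (φ : (Fin d → ℝ) → E → E → I) (a : E) (x : Fin n → Pt d E) (c : Fin d → ℤ) :
    avoidProb P φ a x c ≤ 1 := by
  refine (lintegral_mono fun y => ?_).trans_eq (by rw [lintegral_one, measure_univ])
  refine Finset.prod_le_one' fun u _ => ENNReal.ofReal_le_one.2 ?_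
  linarith [(conn φ y (root a x u)).2.1]

theorem measurable_avoid_integrand {n : ℕ} {φ : (Fin d → ℝ) → E → E → I}
    (hφ : Measurable fun p : (Fin d → ℝ) × E × E => φ p.1 p.2.1 p.2.2) (a : E) :
    Measurable fun p : (Fin n → Pt d E) × Pt d E =>
      ∏ u, ENNReal.ofReal (1 - (conn φ p.2 (root a p.1 u) : ℝ)) := by
  refine Finset.measurable_prod _ fun u _ => ENNReal.measurable_ofReal.comp ?_
  refine measurable_const.sub (measurable_subtype_coe.comp ?_)
  exact (measurable_conn hφ).comp
    (measurable_snd.prodMk ((measurable_root a u).comp measurable_fst))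

theorem measurable_avoidProb {n : ℕ} (P : Measure E) [IsProbabilityMeasure P]
    {φ : (Fin d → ℝ) → E → E → I}
    (hφ : Measurable fun p : (Fin d → ℝ) × E × E => φ p.1 p.2.1 p.2.2) (a : E) (c : Fin d → ℤ) :
    Measurable fun x : Fin n → Pt d E => avoidProb P φ a x c :=
  (measurable_avoid_integrand hφ a).lintegral_prod_right'

theorem measurable_innerProb {n : ℕ} {φ : (Fin d → ℝ) → E → E → I}
    (hφ : Measurable fun p : (Fin d → ℝ) × E × E => φ p.1 p.2.1 p.2.2)
    (hφs : ∀ x b c, φ (-x) c b = φ x b c) (a : E) :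
    Measurable fun x : Fin n → Pt d E => innerProb φ a x :=
  measurable_measure_prodMk_left (measurableSet_innerConnected hφ hφs a)

theorem volume_setOf_not_le (t : I) : (volume : Measure I) {y | ¬ y ≤ t} = ENNReal.ofReal (1 - t) := by
  have h : {y : I | ¬ y ≤ t} = Set.Ioi t := by
    ext y
    simp
  rw [h, unitInterval.volume_Ioi]

/-- The names of inner edges and the names of edges joining an outer point to the cluster are
all distinct. -/
theorem injective_edge_names {ι β : Type*} {n : ℕ} {i : Fin n → ι} {t : β → ι}
    (hi : Function.Injective i) (ht : Function.Injective t) (hit : ∀ b, t b ∉ Set.range i) :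
    Function.Injective (Sum.elim (Sym2.map (Option.map i))
      fun b : β × Option (Fin n) => s(some (t b.1), Option.map i b.2)) := by
  have hoi := Option.map_injective hi
  have hno : ∀ b u, some (t b) ≠ Option.map i u := fun b u h =>
    hit b (mem_range_optionMap.1 ⟨u, h.symm⟩)
  refine (Sym2.map.injective hoi).sumElim ?_ ?_
  · rintro ⟨b, u⟩ ⟨b', u'⟩ h
    rcases Sym2.eq_iff.1 h with ⟨h1, h2⟩ | ⟨h1, -⟩
    · exact Prod.ext (ht (Option.some.inj h1)) (hoi h2)
    · exact absurd h1 (hno b u')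
  · rintro e ⟨b, u⟩ h
    have hmem : some (t b) ∈ Sym2.map (Option.map i) e := by
      rw [h]
      exact Sym2.mem_mk_left _ _
    obtain ⟨v, -, hv⟩ := Sym2.mem_map.1 hmem
    exact hno b v hv.symm

/-- The probability that the points named `i` form a connected graph with the added vertex to which
none of the finitely many points named `t` is joined. -/
theorem confLaw_innerConnected_avoid (P : Measure E) [IsProbabilityMeasure P]
    {φ : (Fin d → ℝ) → E → E → I}
    (hφ : Measurable fun p : (Fin d → ℝ) × E × E => φ p.1 p.2.1 p.2.2)
    (hφs : ∀ x b c, φ (-x) c b = φ x b c) (a : E) {n : ℕ} {β : Type*} [Fintype β]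
    {i : Fin n → PIdx d} {t : β → PIdx d}
    (hi : Function.Injective i) (ht : Function.Injective t) (hit : ∀ b, t b ∉ Set.range i)
    {A : Set ((PIdx d → Pt d E) × (Sym2 (VIdx d) → I))}
    (hA : A = {p | InnerConnected φ a (fun j => p.1 (i j)) (fun s => p.2 (s.map (Option.map i))) ∧
      ∀ (b : β) (u : Option (Fin n)), ¬ p.2 s(some (t b), u.map i) ≤
        conn φ (p.1 (t b)) (root a (fun j => p.1 (i j)) u)}) :
    MeasurableSet A ∧ confLaw d P A =
      ∫⁻ x, innerProb φ a x * ∏ b, avoidProb P φ a x (t b).1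
        ∂Measure.pi fun j => pointLaw P (i j).1 := by
  classical
  have hmI := measurableSet_innerConnected (n := n) hφ hφs a
  have hmA : MeasurableSet A := by
    have h : A = ((fun p : (PIdx d → Pt d E) × (Sym2 (VIdx d) → I) =>
          ((fun j => p.1 (i j)), fun s : Sym2 (Option (Fin n)) => p.2 (s.map (Option.map i)))) ⁻¹'
          {q | InnerConnected φ a q.1 q.2}) ∩
        ⋂ (b : β) (u : Option (Fin n)), {p | p.2 s(some (t b), u.map i) ≤
          conn φ (p.1 (t b)) (root a (fun j => p.1 (i j)) u)}ᶜ := by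
      rw [hA]
      ext p
      simp
    rw [h]
    refine MeasurableSet.inter ?_ (MeasurableSet.iInter fun b => MeasurableSet.iInter fun u =>
      MeasurableSet.compl (measurableSet_le (α := I) (by fun_prop) ?_))
    · refine Measurable.comp (g := fun q => q) measurable_id ?_ hmI
      fun_prop
    · refine (measurable_conn hφ).comp (Measurable.prodMk (by fun_prop) ?_)
      exact (measurable_root a u).comp (by fun_prop)
  refine ⟨hmA, ?_⟩
  rw [confLaw, Measure.prod_apply hmA]
  have hedge : ∀ p : PIdx d → Pt d E,
      (Measure.infinitePi fun _ : Sym2 (VIdx d) => (volume : Measure I)) (Prod.mk p ⁻¹' A) =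
        innerProb φ a (fun j => p (i j)) * ∏ b, ∏ u : Option (Fin n),
          ENNReal.ofReal (1 - conn φ (p (t b)) (root a (fun j => p (i j)) u)) := by
    intro p
    set x : Fin n → Pt d E := fun j => p (i j) with hx
    have hmx : MeasurableSet {e | InnerConnected φ a x e} := measurable_prodMk_left hmI
    have hmq : ∀ b : β × Option (Fin n),
        MeasurableSet {y : I | ¬ y ≤ conn φ (p (t b.1)) (root a x b.2)} := fun b => by
      have : {y : I | ¬ y ≤ conn φ (p (t b.1)) (root a x b.2)} =
          Set.Ioi (conn φ (p (t b.1)) (root a x b.2)) := by ext; simp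
      rw [this]
      exact measurableSet_Ioi
    have h := lintegral_infinitePi_mul_prod (fun _ : Sym2 (VIdx d) => (volume : Measure I)) _ _
      (injective_edge_names hi ht hit) ({e | InnerConnected φ a x e}.indicator 1)
      (measurable_one.indicator hmx)
      (fun b _ => {y : I | ¬ y ≤ conn φ (p (t b.1)) (root a x b.2)}.indicator 1)
      (fun b => (measurable_one.indicator (hmq b)).comp measurable_snd)
    simp_rw [lintegral_indicator_one (hmq _), volume_setOf_not_le] at h
    rw [lintegral_mul_const _ (measurable_one.indicator hmx), lintegral_indicator_one hmx,
      Fintype.prod_prod_type] at h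
    refine Eq.trans ?_ h
    rw [← lintegral_indicator_one (measurable_prodMk_left hmA)]
    refine lintegral_congr fun e => ?_
    by_cases he : e ∈ Prod.mk p ⁻¹' A
    · have he' := he
      rw [hA] at he'
      rw [Set.indicator_of_mem he, Set.indicator_of_mem he'.1, Finset.prod_eq_one]
      · simp
      · rintro ⟨b, u⟩ -
        exact Set.indicator_of_mem (he'.2 b u) _
    · rw [Set.indicator_of_notMem he]
      symm
      rw [hA] at he
      rcases not_and_or.1 he with h1 | h1
      · rw [Set.indicator_of_notMem h1, zero_mul]
      · push Not at h1
        obtain ⟨b, u, hbu⟩ := h1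
        rw [Finset.prod_eq_zero (Finset.mem_univ (b, u)), mul_zero]
        refine Set.indicator_of_notMem ?_ _
        exact not_not.2 hbu
  simp_rw [hedge]
  exact lintegral_infinitePi_mul_prod (fun v : PIdx d => pointLaw P v.1) i t
    (hi.sumElim ht fun j b h => hit b ⟨j, h⟩) _ (measurable_innerProb hφ hφs a)
    (fun _ x y => ∏ u, ENNReal.ofReal (1 - (conn φ y (root a x u) : ℝ)))
    fun b => measurable_avoid_integrand hφ a

open scoped Classical in
/-- The probability, given the counts `N`, that the cluster of the added vertex consists of the
points named `(z j, k j)`. It depends on the names only through the cells `z`. -/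
theorem confLaw_cluster_eq_range (P : Measure E) [IsProbabilityMeasure P]
    {φ : (Fin d → ℝ) → E → E → I}
    (hφ : Measurable fun p : (Fin d → ℝ) × E × E => φ p.1 p.2.1 p.2.2)
    (hφs : ∀ x b c, φ (-x) c b = φ x b c) (a : E) {n : ℕ} {z : Fin n → Fin d → ℤ}
    {k : Fin n → ℕ} {N : (Fin d → ℤ) → ℕ} (h : IsAdmissible z k N) (g : VIdx d → I) :
    confLaw d P {p | cluster φ a (N, p.1, p.2, g) = Set.range (Option.map fun j => (z j, k j))} =
      ∫⁻ x, innerProb φ a x * voidProd (avoidProb P φ a x) (N - mult z)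
        ∂Measure.pi fun j => pointLaw P (z j) := by
  -- The event is the decreasing limit of the events `A Λ`, in which only the points of finitely many
  -- cells have to avoid the cluster.
  set T : Finset (Fin d → ℤ) → Finset (Σ _ : Fin d → ℤ, ℕ) := fun Λ => Λ.sigma (free z k N) with hT
  set A : Finset (Fin d → ℤ) → Set ((PIdx d → Pt d E) × (Sym2 (VIdx d) → I)) := fun Λ =>
    {p | InnerConnected φ a (fun j => p.1 (z j, k j))
        (fun s => p.2 (s.map (Option.map fun j => (z j, k j)))) ∧
      ∀ (b : T Λ) (u : Option (Fin n)),
        ¬ p.2 s(some (b.1.1, b.1.2), u.map fun j => (z j, k j)) ≤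
          conn φ (p.1 (b.1.1, b.1.2)) (root a (fun j => p.1 (z j, k j)) u)} with hA
  have hset : {p : (PIdx d → Pt d E) × (Sym2 (VIdx d) → I) |
      cluster φ a (N, p.1, p.2, g) = Set.range (Option.map fun j => (z j, k j))} = ⋂ Λ, A Λ := by
    ext p
    rw [Set.mem_iInter]
    refine (cluster_eq_range_iff hφs (w := (N, p.1, p.2, g)) h).trans ⟨fun H Λ => ⟨H.1, ?_⟩, fun H =>
      ⟨(H ∅).1, fun c m hm u => ?_⟩⟩
    · rintro ⟨⟨c, m⟩, hb⟩ u
      exact H.2 c m (Finset.mem_sigma.1 hb).2 u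
    · exact (H {c}).2 ⟨⟨c, m⟩, Finset.mem_sigma.2 ⟨Finset.mem_singleton_self c, hm⟩⟩ u
  have hAΛ : ∀ Λ, MeasurableSet (A Λ) ∧ confLaw d P (A Λ) =
      ∫⁻ x, innerProb φ a x * ∏ c ∈ Λ, avoidProb P φ a x c ^ (N - mult z) c
        ∂Measure.pi fun j => pointLaw P (z j) := by
    intro Λ
    have h1 := confLaw_innerConnected_avoid P hφ hφs a (β := T Λ)
      (i := fun j => (z j, k j)) (t := fun b => (b.1.1, b.1.2)) h.2
      (fun b b' hb => by
        rw [Prod.mk.injEq] at hb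
        exact Subtype.ext (Sigma.ext hb.1 (heq_of_eq hb.2)))
      (by
        rintro ⟨⟨c, m⟩, hb⟩ ⟨j, hj⟩
        exact (Finset.mem_filter.1 (Finset.mem_sigma.1 hb).2).2 j hj)
      (A := A Λ) rfl
    refine ⟨h1.1, h1.2.trans (lintegral_congr fun x => ?_)⟩
    congr 1
    rw [Finset.prod_coe_sort (T Λ) fun b => avoidProb P φ a x b.1, hT, Finset.prod_sigma]
    refine Finset.prod_congr rfl fun c _ => ?_
    simp only [Finset.prod_const, card_free h]
    rfl
  have hanti : Antitone A := by
    intro Λ Λ' hΛ p hp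
    refine ⟨hp.1, fun b u => ?_⟩
    exact hp.2 ⟨b.1, Finset.sigma_mono hΛ (fun _ => Finset.Subset.refl _) b.2⟩ u
  rw [hset, hanti.directed_ge.measure_iInter
    (fun Λ => (hAΛ Λ).1.nullMeasurableSet) ⟨∅, measure_ne_top _ _⟩]
  simp_rw [fun Λ => (hAΛ Λ).2]
  have hle : ∀ c (x : Fin n → Pt d E), avoidProb P φ a x c ^ (N - mult z) c ≤ 1 := fun c x =>
    pow_le_one' (avoidProb_le_one P φ a x c) _
  rw [← lintegral_iInf_directed_of_measurable (IsProbabilityMeasure.ne_zero _)]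
  · refine lintegral_congr fun x => ?_
    rw [voidProd, ENNReal.mul_iInf fun h => absurd h
      (ne_top_of_le_ne_top ENNReal.one_ne_top (innerProb_le_one φ a x))]
  · intro Λ
    exact (measurable_innerProb hφ hφs a).mul (Finset.measurable_prod _ fun c _ =>
      (measurable_avoidProb P hφ a c).pow_const _)
  · intro Λ
    refine ne_top_of_le_ne_top ENNReal.one_ne_top ?_
    refine (lintegral_mono fun x => ?_).trans_eq (by rw [lintegral_one, measure_univ])
    exact mul_le_one' (innerProb_le_one φ a x) (Finset.prod_le_one' fun c _ => hle c x)
  · intro Λ Λ'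
    obtain ⟨Λ'', h1, h2⟩ := directed_finset_prod hle Λ Λ'
    exact ⟨Λ'', fun x => mul_le_mul_right (h1 x) _, fun x => mul_le_mul_right (h2 x) _⟩

end

/-! ### The Mecke formula for the cluster size -/

section

open scoped Classical in
/-- A set of size `n + 1` that contains `none` is enumerated by exactly `n!` tuples. -/
theorem tsum_enumerations {ι : Type*} {C : Set (Option ι)} (hC : none ∈ C) (n : ℕ) :
    ∑' i : Fin n → ι, (if Function.Injective i ∧ C = Set.range (Option.map i) then 1 else 0 : ℝ≥0∞) =
      if C.encard = (n + 1 : ℕ) then (n.factorial : ℝ≥0∞) else 0 := by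
  have hcard : ∀ i : Fin n → ι, Function.Injective i →
      (Set.range (Option.map i)).encard = (n + 1 : ℕ) := by
    intro i hi
    rw [← Set.image_univ, (Option.map_injective hi).encard_image, Set.encard_univ]
    simp
  split_ifs with h
  swap
  · refine ENNReal.tsum_eq_zero.2 fun i => if_neg ?_
    rintro ⟨hi, rfl⟩
    exact h (hcard i hi)
  set S : Set ι := some ⁻¹' C with hS
  have hCS : C = insert none (some '' S) := by
    ext v
    rcases v with _ | v <;> simp [hC, hS]
  have hSn : S.encard = n := by
    rw [hCS, Set.encard_insert_of_notMem (by simp), (Option.some_injective ι).encard_image] at h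
    push_cast at h
    exact (ENat.add_left_injective_of_ne_top (ENat.one_ne_top)) h
  have hiff : ∀ i : Fin n → ι, C = Set.range (Option.map i) ↔ Set.range i = S := by
    intro i
    constructor
    · intro hi
      ext v
      rw [hS, Set.mem_preimage, hi, mem_range_optionMap]
    · intro hi
      ext v
      rcases v with _ | v
      · exact ⟨fun _ => ⟨none, rfl⟩, fun _ => hC⟩
      · rw [mem_range_optionMap, hi]
        rfl
  have hfin : S.Finite := Set.finite_of_encard_eq_coe hSn
  have : Fintype S := hfin.fintype
  have hcS : Fintype.card S = n := by
    have := Set.encard_eq_coe_toFinset_card S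
    rw [hSn, Set.toFinset_card] at this
    exact_mod_cast this.symm
  have hinj : Function.Injective fun (e : Fin n ≃ S) (j : Fin n) => (e j : ι) := by
    intro e e' h
    ext j
    exact congrFun h j
  have hrange : {i : Fin n → ι | Function.Injective i ∧ C = Set.range (Option.map i)} =
      Set.range fun (e : Fin n ≃ S) (j : Fin n) => (e j : ι) := by
    ext i
    rw [Set.mem_ofPred_eq, hiff]
    constructor
    · rintro ⟨h1, h2⟩
      exact ⟨(Equiv.ofInjective i h1).trans (Equiv.setCongr h2), rfl⟩
    · rintro ⟨e, rfl⟩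
      refine ⟨Subtype.val_injective.comp e.injective, ?_⟩
      rw [Set.range_comp' Subtype.val e, e.range_eq_univ, Set.image_univ, Subtype.range_coe]
  have htsum : ∑' i : Fin n → ι,
      (if Function.Injective i ∧ C = Set.range (Option.map i) then 1 else 0 : ℝ≥0∞) =
      ∑' _ : {i : Fin n → ι | Function.Injective i ∧ C = Set.range (Option.map i)}, 1 := by
    rw [tsum_subtype _ fun _ => (1 : ℝ≥0∞)]
    simp only [Set.indicator_apply, Set.mem_ofPred_eq]
  rw [htsum, ENNReal.tsum_set_one, hrange, ← Set.image_univ, hinj.encard_image, Set.encard_univ,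
    ENat.card_eq_coe_fintype_card, Fintype.card_equiv (Fintype.equivFinOfCardEq hcS).symm]
  simp

variable {d : ℕ} {E : Type*} [MeasurableSpace E]

theorem measurableSet_cluster_encard {φ : (Fin d → ℝ) → E → E → I}
    (hφ : Measurable fun p : (Fin d → ℝ) × E × E => φ p.1 p.2.1 p.2.2)
    (hφs : ∀ x b c, φ (-x) c b = φ x b c) (a : E) (n : ℕ) :
    MeasurableSet {w : Omega d E | (cluster φ a w).encard = n} := by
  have h : {w : Omega d E | (cluster φ a w).encard = n} =
      ⋃ (s : Finset (VIdx d)) (_ : s.card = n), {w | cluster φ a w = s} := by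
    ext w
    simp only [Set.mem_iUnion, Set.mem_ofPred_eq]
    constructor
    · intro h
      obtain ⟨s, hs⟩ := (Set.finite_of_encard_eq_coe h).exists_finset_coe
      refine ⟨s, ?_, hs.symm⟩
      rw [← hs, Set.encard_coe_eq_coe_finsetCard] at h
      exact_mod_cast h
    · rintro ⟨s, hs, h⟩
      rw [h, Set.encard_coe_eq_coe_finsetCard, hs]
  rw [h]
  exact MeasurableSet.iUnion fun s => MeasurableSet.iUnion fun _ =>
    measurableSet_cluster_eq hφ hφs a s

theorem lintegral_prob (P : Measure E) [IsProbabilityMeasure P] (lam : ℝ)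
    {F : Omega d E → ℝ≥0∞} (hF : Measurable F) :
    ∫⁻ w, F w ∂prob d P lam = ∫⁻ N, ∫⁻ q, ∫⁻ g, F (N, q.1, q.2, g)
      ∂Measure.infinitePi (fun _ : VIdx d => (volume : Measure I)) ∂confLaw d P
        ∂countLaw (Fin d → ℤ) lam.toNNReal := by
  rw [prob, lintegral_prod _ hF.aemeasurable]
  refine lintegral_congr fun N => ?_
  have h1 : Measurable fun p : (PIdx d → Pt d E) × (Sym2 (VIdx d) → I) × (VIdx d → I) => F (N, p) :=
    hF.comp measurable_prodMk_left
  have h2 : Measurable fun p : ((PIdx d → Pt d E) × (Sym2 (VIdx d) → I)) × (VIdx d → I) =>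
      F (N, p.1.1, p.1.2, p.2) := hF.comp (by fun_prop)
  rw [lintegral_prod _ h1.aemeasurable, confLaw, lintegral_prod _ h2.lintegral_prod_right'.aemeasurable]
  refine lintegral_congr fun p => ?_
  have h3 : Measurable fun q : (Sym2 (VIdx d) → I) × (VIdx d → I) => F (N, p, q) :=
    h1.comp measurable_prodMk_left
  exact lintegral_prod _ h3.aemeasurable

/-- Integration of a function that does not depend on the ghost labels. -/
theorem lintegral_prob_of_ghost_free (P : Measure E) [IsProbabilityMeasure P] (lam : ℝ)
    {F : Omega d E → ℝ≥0∞} (hF : Measurable F) (g₀ : VIdx d → I)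
    (h : ∀ N p e g, F (N, p, e, g) = F (N, p, e, g₀)) :
    ∫⁻ w, F w ∂prob d P lam =
      ∫⁻ N, ∫⁻ q, F (N, q.1, q.2, g₀) ∂confLaw d P ∂countLaw (Fin d → ℤ) lam.toNNReal := by
  rw [lintegral_prob P lam hF]
  refine lintegral_congr fun N => lintegral_congr fun q => ?_
  simp_rw [h N q.1 q.2]
  rw [lintegral_const, measure_univ, mul_one]

/-- The expected number of Poisson points that would be joined to the added vertex or to one of the
points `x`, per unit of intensity. It may be infinite, as no integrability of `φ` is assumed. -/
noncomputable def reach {n : ℕ} (P : Measure E) (φ : (Fin d → ℝ) → E → E → I) (a : E)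
    (x : Fin n → Pt d E) : ℝ≥0∞ :=
  ∑' c, (1 - avoidProb P φ a x c)

theorem measurableSet_injective_cluster_eq {φ : (Fin d → ℝ) → E → E → I}
    (hφ : Measurable fun p : (Fin d → ℝ) × E × E => φ p.1 p.2.1 p.2.2)
    (hφs : ∀ x b c, φ (-x) c b = φ x b c) (a : E) {n : ℕ} (i : Fin n → PIdx d) :
    MeasurableSet {w : Omega d E |
      Function.Injective i ∧ cluster φ a w = Set.range (Option.map i)} :=
  (MeasurableSet.const _).inter (measurableSet_cluster_eq hφ hφs a _)

theorem factorial_mul_prob_cluster_encard (P : Measure E) [IsProbabilityMeasure P]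
    {φ : (Fin d → ℝ) → E → E → I}
    (hφ : Measurable fun p : (Fin d → ℝ) × E × E => φ p.1 p.2.1 p.2.2)
    (hφs : ∀ x b c, φ (-x) c b = φ x b c) (a : E) (lam : ℝ) (n : ℕ) :
    n.factorial * prob d P lam {w | (cluster φ a w).encard = (n + 1 : ℕ)} =
      ∑' i : Fin n → PIdx d, prob d P lam
        {w | Function.Injective i ∧ cluster φ a w = Set.range (Option.map i)} := by
  classical
  have hm := measurableSet_injective_cluster_eq hφ hφs a (n := n)
  rw [tsum_congr fun i => (lintegral_indicator_one (hm i)).symm,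
    ← lintegral_tsum fun i => (measurable_one.indicator (hm i)).aemeasurable,
    ← lintegral_indicator_const (measurableSet_cluster_encard hφ hφs a (n + 1))]
  refine lintegral_congr fun w => ?_
  rw [Set.indicator_apply]
  refine (tsum_enumerations (C := cluster φ a w) none_mem_cluster n).symm.trans
    (tsum_congr fun i => ?_)
  by_cases h : Function.Injective i ∧ cluster φ a w = Set.range (Option.map i)
  · rw [if_pos h, Set.indicator_of_mem (by exact h)]
    rfl
  · rw [if_neg h, Set.indicator_of_notMem (by exact h)]

open scoped Classical in
/-- The probability that the cluster consists of the points named `(z j, k j)`, as an expectation over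
the counts. If the names are not admissible, then they repeat or one of the points is absent. -/
theorem prob_injective_cluster_eq (P : Measure E) [IsProbabilityMeasure P]
    {φ : (Fin d → ℝ) → E → E → I}
    (hφ : Measurable fun p : (Fin d → ℝ) × E × E => φ p.1 p.2.1 p.2.2)
    (hφs : ∀ x b c, φ (-x) c b = φ x b c) (a : E) (lam : ℝ) {n : ℕ} (z : Fin n → Fin d → ℤ)
    (k : Fin n → ℕ) :
    prob d P lam {w | Function.Injective (fun j => (z j, k j)) ∧
        cluster φ a w = Set.range (Option.map fun j => (z j, k j))} =
      ∫⁻ N, (if IsAdmissible z k N then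
        ∫⁻ x, innerProb φ a x * voidProd (avoidProb P φ a x) (N - mult z)
          ∂Measure.pi fun j => pointLaw P (z j) else 0)
        ∂countLaw (Fin d → ℤ) lam.toNNReal := by
  have hm := measurableSet_injective_cluster_eq hφ hφs a fun j => (z j, k j)
  set g₀ : VIdx d → I := fun _ => 0
  rw [← lintegral_indicator_one hm, lintegral_prob_of_ghost_free P lam
    (measurable_one.indicator hm) g₀ fun _ _ _ _ => rfl]
  refine lintegral_congr fun N => ?_
  have hemb : Measurable fun q : (PIdx d → Pt d E) × (Sym2 (VIdx d) → I) =>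
      ((N, q.1, q.2, g₀) : Omega d E) := by fun_prop
  refine (lintegral_indicator_one (hemb hm)).trans ?_
  by_cases hk : IsAdmissible z k N
  · rw [if_pos hk]
    refine Eq.trans ?_ (confLaw_cluster_eq_range P hφ hφs a hk g₀)
    congr 1
    ext q
    exact and_iff_right hk.2
  · rw [if_neg hk]
    convert measure_empty (μ := confLaw d P)
    refine Set.eq_empty_of_forall_notMem ?_
    rintro q ⟨hinj, hq⟩
    refine hk ⟨fun j => ?_, hinj⟩
    have hmem : some (z j, k j) ∈ cluster φ a (N, q.1, q.2, g₀) := by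
      rw [hq]
      exact ⟨some j, rfl⟩
    exact present_of_mem_cluster hφs hmem

/-- Mecke formula for the distribution of the size of the cluster of the added vertex. -/
theorem prob_cluster_encard (P : Measure E) [IsProbabilityMeasure P]
    {φ : (Fin d → ℝ) → E → E → I}
    (hφ : Measurable fun p : (Fin d → ℝ) × E × E => φ p.1 p.2.1 p.2.2)
    (hφs : ∀ x b c, φ (-x) c b = φ x b c) (a : E) {lam : ℝ} (hlam : 0 < lam) (n : ℕ) :
    n.factorial * prob d P lam {w | (cluster φ a w).encard = (n + 1 : ℕ)} =
      ∑' z : Fin n → Fin d → ℤ, lam.toNNReal ^ n *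
        ∫⁻ x, innerProb φ a x * expNeg lam.toNNReal (reach P φ a x)
          ∂Measure.pi fun j => pointLaw P (z j) := by
  have hr : lam.toNNReal ≠ 0 := by simpa using hlam
  rw [factorial_mul_prob_cluster_encard P hφ hφs,
    ← (Equiv.arrowProdEquivProdArrow (Fin n) (fun _ => Fin d → ℤ) fun _ => ℕ).symm.tsum_eq,
    ENNReal.tsum_prod']
  refine tsum_congr fun z => ?_
  have hfm : Measurable fun p : (Fin n → Pt d E) × ((Fin d → ℤ) → ℕ) =>
      innerProb φ a p.1 * voidProd (avoidProb P φ a p.1) p.2 :=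
    ((measurable_innerProb hφ hφs a).comp measurable_fst).mul
      (measurable_voidProd fun c => measurable_avoidProb P hφ a c)
  refine (tsum_congr fun k => prob_injective_cluster_eq P hφ hφs a lam z k).trans ?_
  rw [tsum_lintegral_countLaw hr z _ hfm.lintegral_prod_left']
  congr 1
  have hswap : AEMeasurable (Function.uncurry fun N x =>
      innerProb φ a x * voidProd (avoidProb P φ a x) N)
      ((countLaw (Fin d → ℤ) lam.toNNReal).prod (Measure.pi fun j => pointLaw P (z j))) :=
    (hfm.comp measurable_swap).aemeasurable
  rw [lintegral_lintegral_swap hswap]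
  refine lintegral_congr fun x => ?_
  rw [lintegral_const_mul _ (measurable_voidProd_right _),
    lintegral_voidProd hr fun c => avoidProb_le_one P φ a x c, reach]

/-- The law of the cluster size, as a function of the intensity, is a power times a Laplace
transform. Configurations `x` with `reach P φ a x = ∞` do not contribute and are removed from the
measure, which makes the exponent real. -/
theorem exists_prob_cluster_encard_eq_laplace (P : Measure E) [IsProbabilityMeasure P]
    {φ : (Fin d → ℝ) → E → E → I}
    (hφ : Measurable fun p : (Fin d → ℝ) × E × E => φ p.1 p.2.1 p.2.2)
    (hφs : ∀ x b c, φ (-x) c b = φ x b c) (a : E) (n : ℕ) :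
    ∃ (μ : Measure (Fin n → Pt d E)) (V : (Fin n → Pt d E) → ℝ), Measurable V ∧
      ∀ lam : ℝ, 0 < lam → prob d P lam {w | (cluster φ a w).encard = (n + 1 : ℕ)} =
        ENNReal.ofReal lam ^ n * ∫⁻ x, ENNReal.ofReal (Real.exp (-lam * V x)) ∂μ := by
  have hW : Measurable fun x : Fin n → Pt d E => reach P φ a x :=
    Measurable.tsum fun c => measurable_const.sub (measurable_avoidProb P hφ a c)
  have hS : MeasurableSet {x : Fin n → Pt d E | reach P φ a x ≠ ∞} :=
    (hW (measurableSet_singleton ∞)).compl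
  have hinner : Measurable fun x : Fin n → Pt d E => innerProb φ a x :=
    measurable_innerProb hφ hφs a
  refine ⟨(n.factorial : ℝ≥0∞)⁻¹ • (((Measure.sum fun z : Fin n → Fin d → ℤ =>
    Measure.pi fun j => pointLaw P (z j)).withDensity (innerProb φ a)).restrict
      {x | reach P φ a x ≠ ∞}), fun x => (reach P φ a x).toReal, hW.ennreal_toReal,
    fun lam hlam => ?_⟩
  have hn0 : (n.factorial : ℝ≥0∞) ≠ 0 := by exact_mod_cast n.factorial_ne_zero
  have hnt : (n.factorial : ℝ≥0∞) ≠ ∞ := ENNReal.natCast_ne_top _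
  have hexp : Measurable fun x : Fin n → Pt d E =>
      ENNReal.ofReal (Real.exp (-lam * (reach P φ a x).toReal)) :=
    ENNReal.measurable_ofReal.comp
      (Real.measurable_exp.comp (measurable_const.mul hW.ennreal_toReal))
  have hmain := prob_cluster_encard P hφ hφs a hlam n
  rw [ENNReal.tsum_mul_left] at hmain
  rw [lintegral_smul_measure, ← lintegral_indicator hS,
    lintegral_withDensity_eq_lintegral_mul _ hinner (hexp.indicator hS), lintegral_sum_measure,
    smul_eq_mul, mul_left_comm (ENNReal.ofReal lam ^ n)]
  rw [← ENNReal.mul_right_inj hn0 hnt, ← mul_assoc _ _⁻¹, ENNReal.mul_inv_cancel hn0 hnt, one_mul,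
    hmain]
  congr 1
  refine tsum_congr fun z => lintegral_congr fun x => ?_
  rw [Pi.mul_apply, expNeg]
  congr 1
  by_cases hx : reach P φ a x = ∞
  · rw [if_pos hx, Set.indicator_of_notMem]
    exact not_not.2 hx
  · rw [if_neg hx, Set.indicator_of_mem (s := {x | reach P φ a x ≠ ∞}) hx, neg_mul,
      Real.coe_toNNReal _ hlam.le]

end

/-! ### Ghosts and the generating function of the cluster size -/

section

open scoped Classical in
/-- A set of `n` vertices contains no ghost with probability `(1 - γ) ^ n`; an infinite set contains
a ghost almost surely. -/
theorem ghostLaw_avoid {V : Type*} (C : Set V) {γ : ℝ} (hγ : γ ∈ Set.Ioo (0 : ℝ) 1) :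
    Measure.infinitePi (fun _ : V => (volume : Measure I)) {g | ∀ v ∈ C, ¬ (g v : ℝ) ≤ γ} =
      ∑' n : ℕ, if C.encard = n then ENNReal.ofReal (1 - γ) ^ n else 0 := by
  set t : I := ⟨γ, hγ.1.le, hγ.2.le⟩
  have hfin : ∀ s : Finset V, Measure.infinitePi (fun _ : V => (volume : Measure I))
      {g | ∀ v ∈ s, ¬ (g v : ℝ) ≤ γ} = ENNReal.ofReal (1 - γ) ^ s.card := by
    intro s
    have h : {g : V → I | ∀ v ∈ s, ¬ (g v : ℝ) ≤ γ} = Set.pi s fun _ => {y : I | ¬ y ≤ t} := rfl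
    have hm : MeasurableSet {y : I | ¬ y ≤ t} := measurableSet_Iic.compl
    rw [h, Measure.infinitePi_pi _ fun _ _ => hm]
    simp_rw [volume_setOf_not_le]
    rw [Finset.prod_const]
  by_cases hC : C.Finite
  · obtain ⟨s, rfl⟩ := hC.exists_finset_coe
    rw [tsum_eq_single s.card]
    · rw [if_pos (Set.encard_coe_eq_coe_finsetCard s)]
      exact hfin s
    · intro n hn
      refine if_neg fun h => hn ?_
      rw [Set.encard_coe_eq_coe_finsetCard] at h
      exact_mod_cast h.symm
  · have h0 : ∀ n : ℕ, C.encard ≠ n := fun n h => hC (Set.finite_of_encard_eq_coe h)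
    simp only [h0, if_false, tsum_zero]
    have hlim : Filter.Tendsto (fun n : ℕ => ENNReal.ofReal (1 - γ) ^ n) Filter.atTop (nhds 0) := by
      refine ENNReal.tendsto_pow_atTop_nhds_zero_of_lt_one ?_
      rw [ENNReal.ofReal_lt_one]
      linarith [hγ.1]
    refine le_antisymm (ge_of_tendsto' hlim fun n => ?_) zero_le
    obtain ⟨s, hs, hsn⟩ := Set.Infinite.exists_subset_card_eq hC n
    rw [← hsn, ← hfin s]
    exact measure_mono fun g hg v hv => hg v (hs hv)

variable {d : ℕ} {E : Type*} [MeasurableSpace E]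

/-- The probability that the cluster of the added vertex contains no ghost is the generating
function of the cluster size at `1 - γ`. -/
theorem prob_no_ghost (P : Measure E) [IsProbabilityMeasure P]
    {φ : (Fin d → ℝ) → E → E → I}
    (hφ : Measurable fun p : (Fin d → ℝ) × E × E => φ p.1 p.2.1 p.2.2)
    (hφs : ∀ x b c, φ (-x) c b = φ x b c) (a : E) (lam : ℝ) {γ : ℝ} (hγ : γ ∈ Set.Ioo (0 : ℝ) 1) :
    MeasurableSet {w : Omega d E | (cluster φ a w ∩ ghosts γ w).Nonempty} ∧
      prob d P lam {w | (cluster φ a w ∩ ghosts γ w).Nonempty}ᶜ =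
        ∑' n : ℕ, prob d P lam {w | (cluster φ a w).encard = n} * ENNReal.ofReal (1 - γ) ^ n := by
  classical
  have hm : MeasurableSet {w : Omega d E | (cluster φ a w ∩ ghosts γ w).Nonempty} := by
    have h : {w : Omega d E | (cluster φ a w ∩ ghosts γ w).Nonempty} =
        ⋃ v, {w | v ∈ cluster φ a w} ∩ ({w | Present w v} ∩ {w | (w.ghost v : ℝ) ≤ γ}) := by
      ext w
      simp only [Set.mem_iUnion]
      exact Iff.rfl
    rw [h]
    refine MeasurableSet.iUnion fun v => (measurableSet_mem_cluster hφ hφs a v).inter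
      ((measurableSet_present v).inter (measurableSet_le ?_ measurable_const))
    exact measurable_subtype_coe.comp ((measurable_pi_apply v).comp
      (measurable_snd.comp (measurable_snd.comp measurable_snd)))
  refine ⟨hm, ?_⟩
  set g₀ : VIdx d → I := fun _ => 0
  have hms := fun n : ℕ => measurableSet_cluster_encard hφ hφs a n
  rw [tsum_congr fun n => (mul_comm _ _).trans
      (lintegral_indicator_const (hms n) (ENNReal.ofReal (1 - γ) ^ n)).symm,
    ← lintegral_tsum fun n => (measurable_const.indicator (hms n)).aemeasurable,
    lintegral_prob_of_ghost_free P lam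
      (Measurable.tsum fun n => measurable_const.indicator (hms n)) g₀ fun _ _ _ _ => rfl,
    ← lintegral_indicator_one hm.compl, lintegral_prob P lam (measurable_one.indicator hm.compl)]
  refine lintegral_congr fun N => lintegral_congr fun q => ?_
  have hemb : Measurable fun g : VIdx d → I => ((N, q.1, q.2, g) : Omega d E) := by fun_prop
  refine (lintegral_indicator_one (hemb hm.compl)).trans ?_
  have hset : (fun g : VIdx d → I => ((N, q.1, q.2, g) : Omega d E)) ⁻¹'
      {w | (cluster φ a w ∩ ghosts γ w).Nonempty}ᶜ =
        {g | ∀ v ∈ cluster φ a (N, q.1, q.2, g₀), ¬ (g v : ℝ) ≤ γ} := by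
    ext g
    constructor
    · intro h v hv hle
      exact h ⟨v, hv, present_of_mem_cluster hφs (w := (N, q.1, q.2, g)) hv, hle⟩
    · rintro h ⟨v, hv, -, hle⟩
      exact h v hv hle
  rw [hset, ghostLaw_avoid _ hγ]
  refine tsum_congr fun n => ?_
  rw [Set.indicator_apply]
  rfl

/-- The power series of the magnetization in `1 - γ`. -/
theorem magnetization_eq (P : Measure E) [IsProbabilityMeasure P]
    {φ : (Fin d → ℝ) → E → E → I}
    (hφ : Measurable fun p : (Fin d → ℝ) × E × E => φ p.1 p.2.1 p.2.2)
    (hφs : ∀ x b c, φ (-x) c b = φ x b c) (a : E) (lam : ℝ) {γ : ℝ} (hγ : γ ∈ Set.Ioo (0 : ℝ) 1) :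
    magnetization P φ lam γ a =
      1 - ∑' n : ℕ, (prob d P lam).real {w | (cluster φ a w).encard = n} * (1 - γ) ^ n := by
  obtain ⟨hm, h⟩ := prob_no_ghost P hφ hφs a lam hγ
  have h1 := probReal_compl_eq_one_sub (μ := prob d P lam) hm
  have h2 : (prob d P lam).real {w | (cluster φ a w ∩ ghosts γ w).Nonempty}ᶜ =
      ∑' n : ℕ, (prob d P lam).real {w | (cluster φ a w).encard = n} * (1 - γ) ^ n := by
    rw [measureReal_def, h, ENNReal.tsum_toReal_eq fun n =>
      ENNReal.mul_ne_top (measure_ne_top _ _) (ENNReal.pow_ne_top ENNReal.ofReal_ne_top)]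
    refine tsum_congr fun n => ?_
    rw [ENNReal.toReal_mul, ENNReal.toReal_pow, ENNReal.toReal_ofReal (by linarith [hγ.2])]
    rfl
  rw [magnetization, ← h2, h1]
  ring

/-! ### Real-analyticity from locally uniform convergence of complex series -/

/-- A real function that is a constant minus a series whose terms extend to holomorphic functions,
dominated by a summable sequence, is real-analytic. -/
theorem analyticAt_of_complex_series {f : ℝ → ℝ} {F : ℕ → ℂ → ℂ} {u : ℕ → ℝ} {U : Set ℂ} {x : ℝ}
    (hU : IsOpen U) (hx : (x : ℂ) ∈ U) (hu : Summable u)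
    (hF : ∀ n, DifferentiableOn ℂ (F n) U) (hle : ∀ n, ∀ z ∈ U, ‖F n z‖ ≤ u n) {s : ℕ → ℝ → ℝ}
    {c : ℝ} (hs : ∀ᶠ t : ℝ in nhds x, ∀ n, F n t = s n t)
    (hf : ∀ᶠ t : ℝ in nhds x, f t = c - ∑' n, s n t) : AnalyticAt ℝ f x := by
  have hd := Complex.differentiableOn_tsum_of_summable_norm hu hF hU hle
  have ha : AnalyticAt ℂ (fun z => ∑' n, F n z) x := hd.analyticAt (hU.mem_nhds hx)
  refine (analyticAt_const.sub ha.re_ofReal).congr (f := fun t : ℝ => c - (∑' n, F n t).re) ?_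
  filter_upwards [hs, hf] with t h1 h2
  rw [h2, tsum_congr h1, ← Complex.ofReal_tsum, Complex.ofReal_re]

/-- The radius of the disc, `1 - γ / 2`, lies strictly between `1 - γ` and `1`. -/
theorem analyticAt_magnetization_ghost (P : Measure E) [IsProbabilityMeasure P]
    {φ : (Fin d → ℝ) → E → E → I}
    (hφ : Measurable fun p : (Fin d → ℝ) × E × E => φ p.1 p.2.1 p.2.2)
    (hφs : ∀ x b c, φ (-x) c b = φ x b c) (a : E) (lam : ℝ) {γ : ℝ} (hγ : γ ∈ Set.Ioo (0 : ℝ) 1) :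
    AnalyticAt ℝ (fun γ => magnetization P φ lam γ a) γ := by
  obtain ⟨h0, h1⟩ := hγ
  refine analyticAt_of_complex_series (U := Metric.ball 1 (1 - γ / 2)) (c := 1)
    (u := fun n => (1 - γ / 2) ^ n)
    (F := fun n z => ((prob d P lam).real {w | (cluster φ a w).encard = n} : ℂ) * (1 - z) ^ n)
    (s := fun n t => (prob d P lam).real {w | (cluster φ a w).encard = n} * (1 - t) ^ n)
    Metric.isOpen_ball ?_ ?_ ?_ ?_ ?_ ?_
  · rw [Metric.mem_ball, dist_eq_norm, ← Complex.ofReal_one, ← Complex.ofReal_sub,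
      Complex.norm_real, Real.norm_eq_abs, abs_lt]
    constructor <;> linarith
  · exact summable_geometric_of_lt_one (by linarith) (by linarith)
  · exact fun n => by fun_prop
  · intro n z hz
    rw [norm_mul, norm_pow, Complex.norm_real, Real.norm_of_nonneg measureReal_nonneg]
    rw [Metric.mem_ball, dist_comm, dist_eq_norm] at hz
    calc _ ≤ 1 * (1 - γ / 2) ^ n := by
          gcongr
          exact measureReal_le_one
      _ = _ := one_mul _
  · exact Filter.Eventually.of_forall fun t n => by push_cast; rfl
  · filter_upwards [Ioo_mem_nhds h0 h1] with t ht
    exact magnetization_eq P hφ hφs a lam ht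

/-- The analytic continuation to the right half-plane of the law of the cluster size, with its bound
in terms of the law at the real part of the intensity. -/
theorem exists_continuation_prob_cluster (P : Measure E) [IsProbabilityMeasure P]
    {φ : (Fin d → ℝ) → E → E → I}
    (hφ : Measurable fun p : (Fin d → ℝ) × E × E => φ p.1 p.2.1 p.2.2)
    (hφs : ∀ x b c, φ (-x) c b = φ x b c) (a : E) (n : ℕ) :
    ∃ F : ℂ → ℂ, DifferentiableOn ℂ F {z | 0 < z.re} ∧
      (∀ z : ℂ, 0 < z.re → ‖F z‖ ≤ (‖z‖ / z.re) ^ n) ∧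
      ∀ t : ℝ, 0 < t →
        F t = ((prob d P t).real {w | (cluster φ a w).encard = (n + 1 : ℕ)} : ℝ) := by
  obtain ⟨μ, V, hV, h⟩ := exists_prob_cluster_encard_eq_laplace P hφ hφs a n
  have hmeas : ∀ t : ℝ, Measurable fun x => Real.exp (t * V x) := fun t =>
    Real.measurable_exp.comp (measurable_const.mul hV)
  have hint : ∀ t : ℝ, 0 < t → Integrable (fun x => Real.exp (-t * V x)) μ := by
    intro t ht
    refine ⟨(hmeas _).aestronglyMeasurable, ?_⟩
    rw [hasFiniteIntegral_iff_ofReal (Filter.Eventually.of_forall fun x => (Real.exp_pos _).le)]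
    by_contra hcon
    have h1 := h t ht
    rw [not_lt_top_iff.1 hcon, ENNReal.mul_top (pow_ne_zero _ (by simpa using ht))] at h1
    exact measure_ne_top _ _ h1
  have hmgf : ∀ t : ℝ, 0 < t →
      (prob d P t).real {w | (cluster φ a w).encard = (n + 1 : ℕ)} = t ^ n * mgf V μ (-t) := by
    intro t ht
    rw [measureReal_def, h t ht, ENNReal.toReal_mul, ENNReal.toReal_pow,
      ENNReal.toReal_ofReal ht.le, mgf,
      integral_eq_lintegral_of_nonneg_ae (Filter.Eventually.of_forall fun x => (Real.exp_pos _).le)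
        (hmeas _).aestronglyMeasurable]
  refine ⟨fun z => z ^ n * complexMGF V μ (-z), ?_, ?_, ?_⟩
  · have hsub : Set.Iio 0 ⊆ interior (integrableExpSet V μ) := by
      refine interior_maximal (fun t ht => ?_) isOpen_Iio
      have := hint (-t) (neg_pos.2 ht)
      rwa [neg_neg] at this
    refine DifferentiableOn.mul (by fun_prop) ?_
    refine DifferentiableOn.comp (g := complexMGF V μ)
      (t := {z : ℂ | z.re ∈ interior (integrableExpSet V μ)})
      differentiableOn_complexMGF differentiable_neg.differentiableOn fun z hz => hsub ?_
    have hz' : 0 < z.re := hz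
    simpa using hz'
  · intro z hz
    have h1 : z.re ^ n * mgf V μ (-z.re) ≤ 1 := by
      rw [← hmgf _ hz]
      exact measureReal_le_one
    have h2 : ‖complexMGF V μ (-z)‖ ≤ mgf V μ (-z.re) := by
      simpa using norm_complexMGF_le_mgf (X := V) (μ := μ) (z := -z)
    rw [norm_mul, norm_pow, div_pow, div_eq_mul_inv]
    gcongr
    refine h2.trans ?_
    rw [← one_div, le_div_iff₀ (by positivity), mul_comm]
    exact h1
  · intro t ht
    have h1 := complexMGF_ofReal (X := V) (μ := μ) (-t)
    rw [Complex.ofReal_neg] at h1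
    simp only [hmgf t ht, h1, Complex.ofReal_mul, Complex.ofReal_pow]

theorem analyticAt_magnetization_intensity (P : Measure E) [IsProbabilityMeasure P]
    {φ : (Fin d → ℝ) → E → E → I}
    (hφ : Measurable fun p : (Fin d → ℝ) × E × E => φ p.1 p.2.1 p.2.2)
    (hφs : ∀ x b c, φ (-x) c b = φ x b c) (a : E) {lam : ℝ} (hlam : 0 < lam) {γ : ℝ}
    (hγ : γ ∈ Set.Ioo (0 : ℝ) 1) :
    AnalyticAt ℝ (fun lam => magnetization P φ lam γ a) lam := by
  have hγ' := hγ
  obtain ⟨h0, h1⟩ := hγ'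
  choose F hFd hFle hFeq using exists_continuation_prob_cluster P hφ hφs a (d := d)
  -- On the sector `(1 - γ) |z| < (1 - γ / 2) Re z` the series converges geometrically. The index is
  -- shifted by one because the cluster always contains the added vertex.
  refine analyticAt_of_complex_series
    (U := {z | 0 < z.re} ∩ {z | (1 - γ) * ‖z‖ < (1 - γ / 2) * z.re}) (c := 1)
    (u := fun n => (1 - γ / 2) ^ n)
    (F := fun n z => F n z * ((1 - γ : ℝ) : ℂ) ^ (n + 1))
    (s := fun n t =>
      (prob d P t).real {w | (cluster φ a w).encard = (n + 1 : ℕ)} * (1 - γ) ^ (n + 1))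
    ?_ ?_ ?_ ?_ ?_ ?_ ?_
  · exact (isOpen_lt continuous_const Complex.continuous_re).inter
      (isOpen_lt (by fun_prop) (continuous_const.mul Complex.continuous_re))
  · refine ⟨by simpa using hlam, ?_⟩
    change (1 - γ) * ‖(lam : ℂ)‖ < (1 - γ / 2) * (lam : ℂ).re
    rw [Complex.norm_real, Real.norm_of_nonneg hlam.le, Complex.ofReal_re]
    gcongr
    linarith
  · exact summable_geometric_of_lt_one (by linarith) (by linarith)
  · exact fun n => ((hFd n).mono Set.inter_subset_left).mul_const _
  · rintro n z ⟨hz, hz'⟩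
    have hz0 : 0 < z.re := hz
    have hz1 : (1 - γ) * ‖z‖ < (1 - γ / 2) * z.re := hz'
    have hγ1 : 0 ≤ 1 - γ := by linarith
    have hratio : ‖z‖ / z.re * (1 - γ) ≤ 1 - γ / 2 := by
      rw [div_mul_eq_mul_div, div_le_iff₀ hz0]
      linarith
    rw [norm_mul, norm_pow, Complex.norm_real, Real.norm_of_nonneg hγ1]
    calc ‖F n z‖ * (1 - γ) ^ (n + 1) ≤ (‖z‖ / z.re) ^ n * (1 - γ) ^ (n + 1) := by
          gcongr
          exact hFle n z hz0
      _ = (‖z‖ / z.re * (1 - γ)) ^ n * (1 - γ) := by rw [mul_pow, pow_succ, mul_assoc]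
      _ ≤ (1 - γ / 2) ^ n * 1 :=
          mul_le_mul (pow_le_pow_left₀ (by positivity) hratio n) (by linarith) hγ1
            (pow_nonneg (by linarith) n)
      _ = (1 - γ / 2) ^ n := mul_one _
  · filter_upwards [Ioi_mem_nhds hlam] with t ht n
    rw [hFeq n t ht]
    push_cast
    rfl
  · refine Filter.Eventually.of_forall fun t => ?_
    rw [magnetization_eq P hφ hφs a t hγ]
    congr 1
    -- The term of index `0` of the generating function vanishes: the cluster is never empty.
    have hempty : (prob d P t).real {w | (cluster φ a w).encard = ((0 : ℕ) : ℕ∞)} = 0 := by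
      have : {w : Omega d E | (cluster φ a w).encard = ((0 : ℕ) : ℕ∞)} = ∅ := by
        refine Set.eq_empty_of_forall_notMem fun w hw => ?_
        have hw' : cluster φ a w = ∅ := Set.encard_eq_zero.1 hw
        exact Set.notMem_empty none (hw' ▸ none_mem_cluster)
      rw [this, measureReal_empty]
    have hsum : Summable fun n : ℕ =>
        (prob d P t).real {w | (cluster φ a w).encard = n} * (1 - γ) ^ n := by
      refine Summable.of_nonneg_of_le (fun n => mul_nonneg measureReal_nonneg
        (pow_nonneg (by linarith) _)) (fun n => ?_)
        (summable_geometric_of_lt_one (r := 1 - γ) (by linarith) (by linarith))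
      exact mul_le_of_le_one_left (pow_nonneg (by linarith) _) measureReal_le_one
    rw [hsum.tsum_eq_zero_add, hempty, zero_mul, zero_add]

end

end RCM

theorem lemma3p4 {d : ℕ} (hd : 1 ≤ d) {E : Type*} [TopologicalSpace E] [PolishSpace E]
    [MeasurableSpace E] [BorelSpace E] (P : Measure E) [IsProbabilityMeasure P]
    (φ : (Fin d → ℝ) → E → E → unitInterval)
    (hφ_meas : Measurable fun p : (Fin d → ℝ) × E × E => φ p.1 p.2.1 p.2.2)
    (hφ_symm : ∀ (x : Fin d → ℝ) (b c : E), φ (-x) c b = φ x b c) :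
    (∀ (lam : ℝ), 0 ≤ lam → ∀ a : E,
      AnalyticOnNhd ℝ (fun γ : ℝ => RCM.magnetization P φ lam γ a) (Set.Ioo 0 1)) ∧
    (∀ γ ∈ Set.Ioo (0 : ℝ) 1, ∀ a : E,
      AnalyticOnNhd ℝ (fun lam : ℝ => RCM.magnetization P φ lam γ a) (Set.Ioi 0)) :=
  ⟨fun lam _ a _ hγ => RCM.analyticAt_magnetization_ghost P hφ_meas hφ_symm a lam hγ,
    fun _ hγ a _ hlam => RCM.analyticAt_magnetization_intensity P hφ_meas hφ_symm a hlam hγ⟩
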